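/- **Setting.** Let $G$ be a finite-dimensional real Lie group with Lie algebra $\mathfrak g=T_eG$ (bracket from left-invariant vector fields), acting on the left on a finite-dimensional real vector space $V$ by a smooth representation. $G$ acts on $V^*$ by the dual left action $\langle ga,v\rangle=\langle a,g^{-1}v\rangle$; write $\xi a\in V^*$ for the induced infinitesimal action of $\xi\in\mathfrak g$ on $a\in V^*$. Put $\langle \mathrm{ad}^*_\xi\mu,\eta\rangle=\langle\mu,[\xi,\eta]\rangle$ and define the diamond operator $V\times V^*\to\mathfrak g^*$ by $\langle v\diamond a,\xi\rangle=-\langle \xi a,v\rangle$. Let $\mathcal N$ be an undirected graph on the nodes $1,\dots,N$ without loops, with adjacency relation $i\sim j$ and node degrees $d_i$. For $i\sim j$ let $\mathbb J_{ij}:V^*\to V$ be linear maps forming a symmetric interaction tensor: $\langle a,\mathbb J_{ij}b\rangle=\langle b,\mathbb J_{ji}a\rangle$ for all $a,b\in V^*$. Let $$h^{\rm int}_{ij}(g_i,g_j;A_i,A_j)=-\frac1{2\sqrt{d_id_j}}\langle g_i^{-1}A_i,\mathbb J_{ij}\,g_j^{-1}A_j\rangle ,\qquad \big(\mathbb D^{-\frac12}\mathbb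 A\mathbb D^{-\frac12}\boldsymbol a\big)_i=\sum_{j\sim i}\frac1{\sqrt{d_id_j}}\,\mathbb J_{ij}a_j .$$ For each node let $L_i:TG\times V^*\to\mathbb R$ be smooth and invariant under the diagonal left action of $G$, and set $$L(\boldsymbol g,\dot{\boldsymbol g},\boldsymbol a_0)=\sum_iL_i(g_i,\dot g_i,A_i)-\sum_i\sum_{j\sim i}h^{\rm int}_{ij}(g_i,g_j;A_i,A_j),\qquad \boldsymbol a_0=(A_1,\dots,A_N)\in(V^*)^N,$$ $l_i(\xi_i,a_i)=L_i(e,\xi_i,a_i)$, and $l(\boldsymbol\xi,\boldsymbol a)=L(\boldsymbol e,\boldsymbol\xi,\boldsymbol a)=\sum_il_i(\xi_i,a_i)+\frac12\sum_i\sum_{j\sim i}\frac1{\sqrt{d_id_j}}\langle a_i,\mathbb J_{ij}a_j\rangle$. **Theorem.** Let $t_1<t_2$, fix $\boldsymbol a_0=(A_1,\dots,A_N)\in(V^*)^N$, let $\boldsymbol g:[t_1,t_2]\to G^N$ be a smooth curve, and put $\xi_i=g_i^{-1}\dot g_i$ and $a_i=g_i^{-1}A_i$. The following are equivalent. 1.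 Hamilton's principle $\delta\int_{t_1}^{t_2}L(\boldsymbol g,\dot{\boldsymbol g},\boldsymbol a_0)\,dt=0$ holds on $G^N$: for every smooth one-parameter family of curves $\boldsymbol g_\varepsilon:[t_1,t_2]\to G^N$ with $\boldsymbol g_0=\boldsymbol g$ whose variation $\delta\boldsymbol g=\partial_\varepsilon|_{\varepsilon=0}\boldsymbol g_\varepsilon$ vanishes at $t_1$ and $t_2$, the derivative of the action at $\varepsilon=0$ is $0$. 2. $\boldsymbol g$ satisfies the Euler–Lagrange equations for $L(\cdot,\cdot,\boldsymbol a_0)$ on $G^N$, that is, $\frac{d}{dt}\frac{\partial L}{\partial\dot x}=\frac{\partial L}{\partial x}$ on $[t_1,t_2]$ in all local coordinates given by products of smooth charts of $G$. 3. The constrained variational principle $\delta\int_{t_1}^{t_2}l(\boldsymbol\xi,\boldsymbol a)\,dt=0$ holds on $(\mathfrak g\oplus V^*)^N$: the derivative at $\varepsilon=0$ of $\int_{t_1}^{t_2}l(\boldsymbol\xi_\varepsilon,\boldsymbol a_\varepsilon)\,dt$ is $0$ for every smooth one-parameter family $(\boldsymbol\xi_\varepsilon,\boldsymbol a_\varepsilon)$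 that equals $(\boldsymbol\xi,\boldsymbol a)$ at $\varepsilon=0$ and whose variation has the form $$\delta\xi_i=\dot\eta_i+[\xi_i,\eta_i],\qquad \delta a_i=-\eta_ia_i\qquad(i=1,\dots,N)$$ for some smooth $\eta_i:[t_1,t_2]\to\mathfrak g$ vanishing at $t_1$ and $t_2$. 4. The network Euler–Poincaré equations hold on $[t_1,t_2]$ for all $i=1,\dots,N$: $$\frac{d}{dt}\frac{\delta l_i}{\delta\xi_i}=\mathrm{ad}^*_{\xi_i}\frac{\delta l_i}{\delta\xi_i}+\frac{\delta l_i}{\delta a_i}\diamond a_i+\big(\mathbb D^{-\frac12}\mathbb A\mathbb D^{-\frac12}\boldsymbol a\big)_i\diamond a_i,\qquad \frac{da_i}{dt}=-\xi_ia_i .$$ -/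

import Mathlib

open scoped Manifold ContDiff Topology

namespace NetworkEP

noncomputable section

section Representation

variable {E : Type*} [NormedAddCommGroup E] [NormedSpace ℝ E]
  {G : Type*} [TopologicalSpace G] [ChartedSpace E G] [Group G]
  {V : Type*} [NormedAddCommGroup V] [NormedSpace ℝ V]

/-- The left action of `G` on `V*` that is dual to a representation `ρ` of `G` on `V`:
`⟨g a, v⟩ = ⟨a, g⁻¹ v⟩`. -/
def dualAct (ρ : G →* (V →L[ℝ] V)) (g : G) (a : StrongDual ℝ V) : StrongDual ℝ V :=
  a.comp (ρ g⁻¹)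

/-- For fixed `a ∈ V*`, the linear map `ξ ↦ ξ a` from the Lie algebra `𝔤 = T_e G` to `V*`: the
infinitesimal action, i.e. the derivative at the identity of the orbit map `g ↦ g a`.
The tangent space of `G` at the identity is, as a vector space, the model space `E`. -/
def infAct (ρ : G →* (V →L[ℝ] V)) (a : StrongDual ℝ V) : E →L[ℝ] StrongDual ℝ V :=
  mfderiv 𝓘(ℝ, E) 𝓘(ℝ, StrongDual ℝ V) (fun g : G => dualAct ρ g a) 1

/-- The diamond operator `V × V* → 𝔤*`, `⟨v ⋄ a, ξ⟩ = -⟨ξ a, v⟩`. -/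
def diamond (ρ : G →* (V →L[ℝ] V)) (v : V) (a : StrongDual ℝ V) : StrongDual ℝ E :=
  -((NormedSpace.inclusionInDoubleDual ℝ V v).comp (infAct ρ a))

theorem diamond_apply (ρ : G →* (V →L[ℝ] V)) (v : V) (a : StrongDual ℝ V) (ξ : E) :
    diamond ρ v a ξ = -(infAct ρ a ξ v) := rfl

end Representation

section Bidual

variable (V : Type*) [NormedAddCommGroup V] [NormedSpace ℝ V] [FiniteDimensional ℝ V]

theorem inclusionInDoubleDual_bijective :
    Function.Bijective (NormedSpace.inclusionInDoubleDual ℝ V).toLinearMap := by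
  have hinj : Function.Injective (NormedSpace.inclusionInDoubleDual ℝ V).toLinearMap :=
    (NormedSpace.inclusionInDoubleDualLi (E := V) ℝ).injective
  have e1 : Module.finrank ℝ (StrongDual ℝ V) = Module.finrank ℝ V := by
    rw [← (LinearMap.toContinuousLinearMap (𝕜 := ℝ) (E := V) (F' := ℝ)).finrank_eq]
    exact Subspace.dual_finrank_eq
  have e2 : Module.finrank ℝ (StrongDual ℝ (StrongDual ℝ V)) =
      Module.finrank ℝ (StrongDual ℝ V) := by
    rw [← (LinearMap.toContinuousLinearMap (𝕜 := ℝ) (E := StrongDual ℝ V) (F' := ℝ)).finrank_eq]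
    exact Subspace.dual_finrank_eq
  exact ⟨hinj, (LinearMap.injective_iff_surjective_of_finrank_eq_finrank (e1.symm.trans e2.symm)).1
    hinj⟩

/-- The canonical identification `V ≅ V**` of a finite-dimensional space with its bidual. -/
def bidualEquiv : V ≃ₗ[ℝ] StrongDual ℝ (StrongDual ℝ V) :=
  LinearEquiv.ofBijective (NormedSpace.inclusionInDoubleDual ℝ V).toLinearMap
    (inclusionInDoubleDual_bijective V)

variable {V}

/-- The functional derivative `δf/δa ∈ V` of a function `f` on `V*`: the element of `V` with
`⟨b, δf/δa⟩ = Df(a) b` for all `b ∈ V*`. -/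
def varDeriv (f : StrongDual ℝ V → ℝ) (a : StrongDual ℝ V) : V :=
  (bidualEquiv V).symm (fderiv ℝ f a)

theorem apply_varDeriv (f : StrongDual ℝ V → ℝ) (a b : StrongDual ℝ V) :
    b (varDeriv f a) = fderiv ℝ f a b := by
  have h : bidualEquiv V (varDeriv f a) = fderiv ℝ f a := (bidualEquiv V).apply_symm_apply _
  exact congrArg (fun φ : StrongDual ℝ (StrongDual ℝ V) => φ b) h

end Bidual

section LieAlgebra

variable {E : Type*} [NormedAddCommGroup E] [NormedSpace ℝ E]
  (G : Type*) [TopologicalSpace G] [ChartedSpace E G] [Group G]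

/-- The Lie bracket of `𝔤 = T_e G` (Mathlib's bracket on `GroupLieAlgebra`, which is given by
left-invariant vector fields), with `T_e G` written as the model space `E`. -/
def lieBr (ξ η : E) : E :=
  @Bracket.bracket (GroupLieAlgebra 𝓘(ℝ, E) G) (GroupLieAlgebra 𝓘(ℝ, E) G) inferInstance ξ η

/-- The adjoint operator `ad_ξ η = [ξ, η]`. -/
def ad [FiniteDimensional ℝ E] [LieGroup 𝓘(ℝ, E) ∞ G] (ξ : E) : E →L[ℝ] E :=
  haveI : CompleteSpace E := FiniteDimensional.complete ℝ E
  haveI : LieGroup 𝓘(ℝ, E) (minSmoothness ℝ 3) G :=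
    LieGroup.of_le (n := ∞) (by simpa using (ENat.LEInfty.out : (3 : WithTop ℕ∞) ≤ ∞))
  LinearMap.toContinuousLinearMap
    { toFun := fun η => lieBr G ξ η
      map_add' := fun η ζ => (LieAlgebra.ad ℝ (GroupLieAlgebra 𝓘(ℝ, E) G) ξ).map_add η ζ
      map_smul' := fun c η => (LieAlgebra.ad ℝ (GroupLieAlgebra 𝓘(ℝ, E) G) ξ).map_smul c η }

/-- The coadjoint operator `⟨ad*_ξ μ, η⟩ = ⟨μ, [ξ, η]⟩`. -/
def adStar [FiniteDimensional ℝ E] [LieGroup 𝓘(ℝ, E) ∞ G] (ξ : E) (μ : StrongDual ℝ E) :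
    StrongDual ℝ E :=
  μ.comp (ad G ξ)

theorem adStar_apply [FiniteDimensional ℝ E] [LieGroup 𝓘(ℝ, E) ∞ G] (ξ η : E)
    (μ : StrongDual ℝ E) : adStar G ξ μ η = μ (lieBr G ξ η) := rfl

end LieAlgebra

section Lagrangians

variable {E : Type*} [NormedAddCommGroup E] [NormedSpace ℝ E]
  {G : Type*} [TopologicalSpace G] [ChartedSpace E G] [Group G]
  {V : Type*} [NormedAddCommGroup V] [NormedSpace ℝ V] {N : ℕ}

/-- The position coupled interaction energy
`h_ij(g_i, g_j; A_i, A_j) = - (2 √(d_i d_j))⁻¹ ⟨g_i⁻¹ A_i, J_ij g_j⁻¹ A_j⟩`. -/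
def interactionEnergy (𝒩 : SimpleGraph (Fin N)) [DecidableRel 𝒩.Adj]
    (ρ : G →* (V →L[ℝ] V)) (J : Fin N → Fin N → StrongDual ℝ V →L[ℝ] V) (i j : Fin N)
    (g₁ g₂ : G) (A₁ A₂ : StrongDual ℝ V) : ℝ :=
  -(1 / (2 * √((𝒩.degree i : ℝ) * 𝒩.degree j))) * (dualAct ρ g₁⁻¹ A₁) (J i j (dualAct ρ g₂⁻¹ A₂))

/-- The full Lagrangian on `T G^N × (V*)^N`,
`L = ∑_i L_i(g_i, ġ_i, A_i) - ∑_i ∑_{j ∼ i} h_ij(g_i, g_j; A_i, A_j)`.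
A point of `T(G^N) = (TG)^N` is an `N`-tuple of points of `TG`. -/
def fullLagrangian (𝒩 : SimpleGraph (Fin N)) [DecidableRel 𝒩.Adj]
    (ρ : G →* (V →L[ℝ] V)) (J : Fin N → Fin N → StrongDual ℝ V →L[ℝ] V)
    (L : Fin N → TangentBundle 𝓘(ℝ, E) G → StrongDual ℝ V → ℝ)
    (p : Fin N → TangentBundle 𝓘(ℝ, E) G) (A : Fin N → StrongDual ℝ V) : ℝ :=
  (∑ i, L i (p i) (A i)) -
    ∑ i, ∑ j ∈ 𝒩.neighborFinset i,
      interactionEnergy 𝒩 ρ J i j (p i).proj (p j).proj (A i) (A j)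

/-- The vector `ξ ∈ 𝔤` as a point of `TG`, over the identity. -/
def atOne (G : Type*) [TopologicalSpace G] [ChartedSpace E G] [Group G] (ξ : E) :
    TangentBundle 𝓘(ℝ, E) G :=
  ⟨1, ξ⟩

/-- The reduced node Lagrangian `l_i(ξ, a) = L_i(e, ξ, a)`. -/
def nodeReduced (L : Fin N → TangentBundle 𝓘(ℝ, E) G → StrongDual ℝ V → ℝ) (i : Fin N)
    (ξ : E) (a : StrongDual ℝ V) : ℝ :=
  L i (atOne G ξ) a

/-- The reduced Lagrangian `l(ξ, a) = L(e, ξ, a)` on `(𝔤 ⊕ V*)^N`. -/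
def reducedLagrangian (𝒩 : SimpleGraph (Fin N)) [DecidableRel 𝒩.Adj]
    (ρ : G →* (V →L[ℝ] V)) (J : Fin N → Fin N → StrongDual ℝ V →L[ℝ] V)
    (L : Fin N → TangentBundle 𝓘(ℝ, E) G → StrongDual ℝ V → ℝ)
    (ξ : Fin N → E) (a : Fin N → StrongDual ℝ V) : ℝ :=
  fullLagrangian 𝒩 ρ J L (fun i => atOne G (ξ i)) a

/-- The `i`-th entry of `D^{-1/2} 𝔸 D^{-1/2} a`, where `𝔸_ij = J_ij` if `i ∼ j` and `0` otherwise
and `D` is the degree matrix. -/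
def coupling (𝒩 : SimpleGraph (Fin N)) [DecidableRel 𝒩.Adj]
    (J : Fin N → Fin N → StrongDual ℝ V →L[ℝ] V) (a : Fin N → StrongDual ℝ V) (i : Fin N) : V :=
  ∑ j ∈ 𝒩.neighborFinset i, (1 / √((𝒩.degree i : ℝ) * 𝒩.degree j)) • J i j (a j)

/-- The reduced Lagrangian is
`∑_i l_i(ξ_i, a_i) + (1/2) ∑_i ∑_{j ∼ i} (d_i d_j)^{-1/2} ⟨a_i, J_ij a_j⟩`. -/
theorem reducedLagrangian_eq (𝒩 : SimpleGraph (Fin N)) [DecidableRel 𝒩.Adj]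
    (ρ : G →* (V →L[ℝ] V)) (J : Fin N → Fin N → StrongDual ℝ V →L[ℝ] V)
    (L : Fin N → TangentBundle 𝓘(ℝ, E) G → StrongDual ℝ V → ℝ)
    (ξ : Fin N → E) (a : Fin N → StrongDual ℝ V) :
    reducedLagrangian 𝒩 ρ J L ξ a = (∑ i, nodeReduced L i (ξ i) (a i)) +
      (1 / 2) * ∑ i, (a i) (coupling 𝒩 J a i) := by
  have h : ∀ b : StrongDual ℝ V, dualAct ρ (1 : G)⁻¹ b = b := by
    intro b; ext v; simp [dualAct]
  simp only [reducedLagrangian, fullLagrangian, nodeReduced, interactionEnergy, coupling, atOne, h,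
    map_sum, map_smul, smul_eq_mul, Finset.mul_sum, sub_eq_add_neg, ← Finset.sum_neg_distrib]
  congr 1
  refine Finset.sum_congr rfl fun i _ => Finset.sum_congr rfl fun j _ => ?_
  rw [one_div, one_div, mul_inv]
  ring

end Lagrangians

section Curves

variable {E : Type*} [NormedAddCommGroup E] [NormedSpace ℝ E]
  {G : Type*} [TopologicalSpace G] [ChartedSpace E G]
  {V : Type*} [NormedAddCommGroup V] [NormedSpace ℝ V] {N : ℕ}

/-- The tangent lift `(c(t), ċ(t)) ∈ TG` of a curve `c` defined on the interval `I`
(with one-sided derivatives at the endpoints of `I`). -/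
def tangentLift (I : Set ℝ) (c : ℝ → G) (t : ℝ) : TangentBundle 𝓘(ℝ, E) G :=
  ⟨c t, mfderivWithin 𝓘(ℝ, ℝ) 𝓘(ℝ, E) c I t (1 : ℝ)⟩

/-- The reduced velocity `ξ(t) = c(t)⁻¹ ċ(t) ∈ 𝔤`. -/
def bodyVelocity [Group G] (I : Set ℝ) (c : ℝ → G) (t : ℝ) : E :=
  mfderiv 𝓘(ℝ, E) 𝓘(ℝ, E) (fun h : G => (c t)⁻¹ * h) (c t) (tangentLift (E := E) I c t).2

/-- Hamilton's principle on `G^N` for the Lagrangian `Λ` on `T(G^N) = (TG)^N` along the curve `g`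
on `[t₁, t₂]`: the action is stationary along every smooth one-parameter family `γ_ε` of curves
with `γ_0 = g` whose variation `δg = ∂γ_ε/∂ε|_{ε=0}` vanishes at the two endpoints. -/
def HamiltonPrinciple (Λ : (Fin N → TangentBundle 𝓘(ℝ, E) G) → ℝ) (t₁ t₂ : ℝ)
    (g : ℝ → Fin N → G) : Prop :=
  ∀ (δ : ℝ) (γ : ℝ → ℝ → Fin N → G), 0 < δ →
    (∀ i, ContMDiffOn 𝓘(ℝ, ℝ × ℝ) 𝓘(ℝ, E) ∞ (fun p : ℝ × ℝ => γ p.1 p.2 i)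
      (Set.Ioo (-δ) δ ×ˢ Set.Icc t₁ t₂)) →
    (∀ t ∈ Set.Icc t₁ t₂, γ 0 t = g t) →
    (∀ i, mfderiv 𝓘(ℝ, ℝ) 𝓘(ℝ, E) (fun ε => γ ε t₁ i) 0 = 0) →
    (∀ i, mfderiv 𝓘(ℝ, ℝ) 𝓘(ℝ, E) (fun ε => γ ε t₂ i) 0 = 0) →
    HasDerivAt (fun ε => ∫ t in t₁..t₂,
      Λ (fun i => tangentLift (E := E) (Set.Icc t₁ t₂) (fun s => γ ε s i) t)) 0 0

/-- The Lagrangian `Λ` in the local coordinates of `T(G^N)` given by charts `e_i` of `G`. -/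
def localLagrangian (Λ : (Fin N → TangentBundle 𝓘(ℝ, E) G) → ℝ)
    (e : Fin N → OpenPartialHomeomorph G E) (x v : Fin N → E) : ℝ :=
  Λ (fun i => ⟨(e i).symm (x i), mfderiv 𝓘(ℝ, E) 𝓘(ℝ, E) (e i).symm (x i) (v i)⟩)

/-- The Euler-Lagrange equations on `G^N` for `Λ` along the curve `g` on `[t₁, t₂]`: in all smooth
charts `e_1, …, e_N` of `G` around `g_1(t), …, g_N(t)`, with `x_i = e_i ∘ g_i`, one has
`d/dt (∂Λ/∂v)(x, ẋ) = (∂Λ/∂x)(x, ẋ)`. -/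
def EulerLagrange (Λ : (Fin N → TangentBundle 𝓘(ℝ, E) G) → ℝ) (t₁ t₂ : ℝ)
    (g : ℝ → Fin N → G) : Prop :=
  ∀ t ∈ Set.Icc t₁ t₂, ∀ e : Fin N → OpenPartialHomeomorph G E,
    (∀ i, e i ∈ IsManifold.maximalAtlas 𝓘(ℝ, E) ∞ G ∧ g t i ∈ (e i).source) →
    let x : ℝ → Fin N → E := fun s i => e i (g s i)
    let v : ℝ → Fin N → E := derivWithin x (Set.Icc t₁ t₂)
    HasDerivWithinAt (fun s => fderiv ℝ (fun w => localLagrangian Λ e (x s) w) (v s))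
      (fderiv ℝ (fun y => localLagrangian Λ e y (v t)) (x t)) (Set.Icc t₁ t₂) t

/-- The constrained variational principle on `(𝔤 ⊕ V*)^N` for `l` along the curve `(ξ, a)` on
`[t₁, t₂]`: the integral of `l` is stationary along every smooth one-parameter family
`(ξ_ε, a_ε)` with `(ξ_0, a_0) = (ξ, a)` whose variation has the form
`δξ_i = η̇_i + [ξ_i, η_i]`, `δa_i = - η_i a_i`, where the smooth curves `η_i` in `𝔤` vanish at the
two endpoints. -/
def ConstrainedPrinciple [Group G] (ρ : G →* (V →L[ℝ] V))
    (l : (Fin N → E) → (Fin N → StrongDual ℝ V) → ℝ) (t₁ t₂ : ℝ)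
    (ξ : ℝ → Fin N → E) (a : ℝ → Fin N → StrongDual ℝ V) : Prop :=
  ∀ (η : ℝ → Fin N → E) (δ : ℝ) (Ξ : ℝ → ℝ → Fin N → E) (α : ℝ → ℝ → Fin N → StrongDual ℝ V),
    ContDiffOn ℝ ∞ η (Set.Icc t₁ t₂) → η t₁ = 0 → η t₂ = 0 → 0 < δ →
    ContDiffOn ℝ ∞ (fun p : ℝ × ℝ => Ξ p.1 p.2) (Set.Ioo (-δ) δ ×ˢ Set.Icc t₁ t₂) →
    ContDiffOn ℝ ∞ (fun p : ℝ × ℝ => α p.1 p.2) (Set.Ioo (-δ) δ ×ˢ Set.Icc t₁ t₂) →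
    (∀ t ∈ Set.Icc t₁ t₂, Ξ 0 t = ξ t ∧ α 0 t = a t) →
    (∀ t ∈ Set.Icc t₁ t₂, ∀ i,
      HasDerivAt (fun ε => Ξ ε t i)
        (derivWithin (fun s => η s i) (Set.Icc t₁ t₂) t + lieBr G (ξ t i) (η t i)) 0 ∧
      HasDerivAt (fun ε => α ε t i) (-(infAct ρ (a t i) (η t i))) 0) →
    HasDerivAt (fun ε => ∫ t in t₁..t₂, l (Ξ ε t) (α ε t)) 0 0

/-- The network Euler-Poincaré equations on `(𝔤 ⊕ V*)^N` along the curve `(ξ, a)` on `[t₁, t₂]`: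
`d/dt δl_i/δξ_i = ad*_{ξ_i} δl_i/δξ_i + δl_i/δa_i ⋄ a_i + (D^{-1/2} 𝔸 D^{-1/2} a)_i ⋄ a_i` and
`da_i/dt = - ξ_i a_i`. -/
def EulerPoincare [Group G] [FiniteDimensional ℝ E] [LieGroup 𝓘(ℝ, E) ∞ G]
    [FiniteDimensional ℝ V] (𝒩 : SimpleGraph (Fin N)) [DecidableRel 𝒩.Adj]
    (ρ : G →* (V →L[ℝ] V)) (J : Fin N → Fin N → StrongDual ℝ V →L[ℝ] V)
    (l : Fin N → E → StrongDual ℝ V → ℝ) (t₁ t₂ : ℝ)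
    (ξ : ℝ → Fin N → E) (a : ℝ → Fin N → StrongDual ℝ V) : Prop :=
  ∀ t ∈ Set.Icc t₁ t₂, ∀ i,
    HasDerivWithinAt (fun s => fderiv ℝ (fun ζ => l i ζ (a s i)) (ξ s i))
      (adStar G (ξ t i) (fderiv ℝ (fun ζ => l i ζ (a t i)) (ξ t i)) +
        diamond ρ (varDeriv (fun b => l i (ξ t i) b) (a t i)) (a t i) +
        diamond ρ (coupling 𝒩 J (a t) i) (a t i)) (Set.Icc t₁ t₂) t ∧
    HasDerivWithinAt (fun s => a s i) (-(infAct ρ (a t i) (ξ t i))) (Set.Icc t₁ t₂) t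

end Curves

end

end NetworkEP

/-! Left translation turns everything on `TG` into objects on the Lie algebra. Applying the
invariance of `L i` with the group element `g_i⁻¹`, separately at each node, and noting that the
interaction sees only `a_i = g_i⁻¹ A_i`, one gets `L(g, ġ, A) = l(ξ, a)`
(`fullLagrangian_eq_reduced`), so the two action integrals coincide along any family of curves.

A family of curves with `η = g⁻¹ δg` induces `δξ = η̇ + [ξ, η]` and `δa = -η a`
(`family_variation`). The first identity is equality of mixed partials combined with the
Maurer-Cartan equation (`maurerCartan_equation`); the second is the derivative of the orbit map. For
every family with such a variation, the derivative of the reduced action is `∫ ∑ ⟨μ_i, η̇_i⟩ + ⟨F_i,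
η_i⟩`, where `μ_i = δl_i/δξ_i` and `F_i` is the Euler-Poincaré force `epForce`
(`hasDerivAt_reduced_action`). The symmetry of the interaction tensor makes the two halves of the
derivative of the coupling energy equal, which absorbs the factor `1/2`.

Conditions 1, 3 and 4 are then linked in a cycle. From 4 to 3: if `μ_i' = F_i`, the integrand is the
derivative of `∑ ⟨μ_i, η_i⟩`, which vanishes at the endpoints. From 3 to 1: families of curves in
the group give admissible reduced families. From 1 to 4: every `η` is realised by some family of
curves (`exists_family_of_variation`), and the fundamental lemma of the calculus of variations
applies. The cycle never requires lifting a reduced family to the group.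

Conditions 2 and 4 are compared pointwise in a chart, with `ω` the Maurer-Cartan form in
coordinates. The coordinate momentum is `μ ∘ ω(x)`, and the Maurer-Cartan equation makes the terms
containing derivatives of `ω` cancel, so that the Euler-Lagrange defect is `(μ_i' - F_i) ∘ ω_i`. As
`ω_i` is invertible, one defect vanishes exactly when the other does. The equation `a_i' = -ξ_i a_i`
holds automatically. -/

open scoped Manifold ContDiff Topology

namespace NetworkEP

noncomputable section

/-! ### Charts of the group and their derivatives -/

section Charts

variable {E : Type*} [NormedAddCommGroup E] [NormedSpace ℝ E]
  {G : Type*} [TopologicalSpace G] [ChartedSpace E G]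

theorem contMDiffAt_chart_symm {e : OpenPartialHomeomorph G E}
    (he : e ∈ IsManifold.maximalAtlas 𝓘(ℝ, E) ∞ G) {x : E} (hx : x ∈ e.target) :
    ContMDiffAt 𝓘(ℝ, E) 𝓘(ℝ, E) ∞ e.symm x :=
  (contMDiffOn_symm_of_mem_maximalAtlas he).contMDiffAt (e.open_target.mem_nhds hx)

theorem contMDiffAt_chart {e : OpenPartialHomeomorph G E}
    (he : e ∈ IsManifold.maximalAtlas 𝓘(ℝ, E) ∞ G) {g : G} (hg : g ∈ e.source) :
    ContMDiffAt 𝓘(ℝ, E) 𝓘(ℝ, E) ∞ e g :=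
  (contMDiffOn_of_mem_maximalAtlas he).contMDiffAt (e.open_source.mem_nhds hg)

/-- The derivative of a map from the model space to `G`, as a linear map of the model space. -/
def modelDeriv (f : E → G) (x : E) : E →L[ℝ] E :=
  mfderiv 𝓘(ℝ, E) 𝓘(ℝ, E) f x

/-- Tangent vectors at `k` are represented through the preferred chart at `k`, so the manifold
derivative is an ordinary derivative read in that chart. The separate name `k` serves the case where
`f x` equals `1` only propositionally. -/
theorem modelDeriv_eq_fderiv {f : E → G} {x : E}
    (hf : MDifferentiableAt 𝓘(ℝ, E) 𝓘(ℝ, E) f x) {k : G} (hk : f x = k) :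
    modelDeriv f x = fderiv ℝ (fun y => chartAt E k (f y)) x := by
  subst hk
  have h := hf.hasMFDerivAt.2
  have h' : HasFDerivWithinAt (fun y => chartAt E (f x) (f y)) (modelDeriv f x) Set.univ x := by
    simp only [mfld_simps] at h
    exact h
  rw [hasFDerivWithinAt_univ] at h'
  exact h'.fderiv.symm

theorem modelDeriv_chart_symm_injective {e : OpenPartialHomeomorph G E}
    (he : e ∈ IsManifold.maximalAtlas 𝓘(ℝ, E) ∞ G) {x : E} (hx : x ∈ e.target) :
    Function.Injective (modelDeriv e.symm x) := by
  have h1 := (contMDiffAt_chart_symm he hx).mdifferentiableAt (by simp)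
  have h2 := (contMDiffAt_chart he (e.map_target hx)).mdifferentiableAt (by simp)
  have h3 := mfderiv_comp x h2 h1
  have h4 : e ∘ e.symm =ᶠ[𝓝 x] id := by
    filter_upwards [e.open_target.mem_nhds hx] with y hy using e.right_inv hy
  rw [h4.mfderiv_eq, mfderiv_id] at h3
  exact Function.LeftInverse.injective
    (g := fun v : E => (mfderiv 𝓘(ℝ, E) 𝓘(ℝ, E) e (e.symm x) v : E))
    fun v => congrArg (fun T : E →L[ℝ] E => T v) h3.symm

theorem modelDeriv_chart_symm_isInvertible [FiniteDimensional ℝ E]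
    {e : OpenPartialHomeomorph G E}
    (he : e ∈ IsManifold.maximalAtlas 𝓘(ℝ, E) ∞ G) {x : E} (hx : x ∈ e.target) :
    (modelDeriv e.symm x).IsInvertible :=
  ⟨(LinearEquiv.ofInjectiveEndo (modelDeriv e.symm x).toLinearMap
    (modelDeriv_chart_symm_injective he hx)).toContinuousLinearEquiv, by ext v; rfl⟩

end Charts

/-! ### The left Maurer-Cartan form, intrinsically and in a chart -/

section MaurerCartan

variable (E : Type*) [NormedAddCommGroup E] [NormedSpace ℝ E]
  {G : Type*} [TopologicalSpace G] [ChartedSpace E G] [Group G]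

/-- The left Maurer-Cartan form of `G`, `v ↦ g⁻¹ v`. -/
def maurerCartan (g : G) : E →L[ℝ] E :=
  mfderiv 𝓘(ℝ, E) 𝓘(ℝ, E) (fun h : G => g⁻¹ * h) g

/-- The derivative `ξ ↦ g ξ` at the identity of the left multiplication by `g`. -/
def leftTranslate (g : G) : E →L[ℝ] E :=
  mfderiv 𝓘(ℝ, E) 𝓘(ℝ, E) (fun h : G => g * h) 1

variable {E}

/-- The Maurer-Cartan form in the chart `e` of `G`. -/
def chartMC (e : OpenPartialHomeomorph G E) (x : E) : E →L[ℝ] E :=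
  fderiv ℝ (fun y => chartAt E (1 : G) ((e.symm x)⁻¹ * e.symm y)) x

theorem lieBr_swap (ζ θ : E) : lieBr G ζ θ = -lieBr G θ ζ :=
  VectorField.mlieBracket_swap_apply (I := 𝓘(ℝ, E)) (M := G)

variable [LieGroup 𝓘(ℝ, E) ∞ G]

theorem contMDiffAt_leftMul (k g : G) :
    ContMDiffAt 𝓘(ℝ, E) 𝓘(ℝ, E) ∞ (fun h : G => k * h) g :=
  contMDiff_mul_left.contMDiffAt

/-- Chain rule for `y ↦ (e.symm x)⁻¹ * e.symm y`. This map takes the value `1` at `y = x`, so its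
derivative is read in the chart at the identity, as in `chartMC`. -/
theorem maurerCartan_modelDeriv_symm {e : OpenPartialHomeomorph G E}
    (he : e ∈ IsManifold.maximalAtlas 𝓘(ℝ, E) ∞ G) {x : E} (hx : x ∈ e.target) (v : E) :
    maurerCartan E (e.symm x) (modelDeriv e.symm x v) = chartMC e x v := by
  have h1 := (contMDiffAt_chart_symm he hx).mdifferentiableAt (by simp)
  have h2 := (contMDiffAt_leftMul (E := E) (e.symm x)⁻¹ (e.symm x)).mdifferentiableAt (by simp)
  have h3 := mfderiv_comp x h2 h1
  have h4 := modelDeriv_eq_fderiv (h2.comp x h1) (k := 1) (by simp)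
  exact congrArg (fun T : E →L[ℝ] E => T v) (h3.symm.trans h4)

/-- `chartMC e` is the partial derivative in the second variable, on the diagonal, of a map that is
jointly smooth in two variables. -/
theorem contDiffAt_chartMC {e : OpenPartialHomeomorph G E}
    (he : e ∈ IsManifold.maximalAtlas 𝓘(ℝ, E) ∞ G) {x : E} (hx : x ∈ e.target) :
    ContDiffAt ℝ ∞ (chartMC e) x := by
  have h1 := contMDiffAt_chart_symm he hx
  have ha : ContMDiffAt 𝓘(ℝ, E × E) 𝓘(ℝ, E) ∞ (fun p : E × E => e.symm p.1) (x, x) :=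
    ContMDiffAt.comp (x, x) (g := e.symm) h1 contDiffAt_fst.contMDiffAt
  have hb : ContMDiffAt 𝓘(ℝ, E × E) 𝓘(ℝ, E) ∞ (fun p : E × E => e.symm p.2) (x, x) :=
    ContMDiffAt.comp (x, x) (g := e.symm) h1 contDiffAt_snd.contMDiffAt
  have h2 : ContMDiffAt 𝓘(ℝ, E × E) 𝓘(ℝ, E) ∞
      (fun p : E × E => (e.symm p.1)⁻¹ * e.symm p.2) (x, x) :=
    (ha.inv).mul hb
  have h3 : ContMDiffAt 𝓘(ℝ, E) 𝓘(ℝ, E) ∞ (chartAt E (1 : G)) ((e.symm x)⁻¹ * e.symm x) := by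
    rw [inv_mul_cancel]
    exact contMDiffAt_chart (IsManifold.chart_mem_maximalAtlas 1) (mem_chart_source E 1)
  have h4 : ContDiffAt ℝ ∞
      (fun p : E × E => chartAt E (1 : G) ((e.symm p.1)⁻¹ * e.symm p.2)) (x, x) :=
    (ContMDiffAt.comp (x, x) (g := chartAt E (1 : G)) h3 h2).contDiffAt
  exact ContDiffAt.fderiv (f := fun x y => chartAt E (1 : G) ((e.symm x)⁻¹ * e.symm y))
    (g := fun x => x) (n := ∞) h4 contDiffAt_id (by simp)

theorem maurerCartan_leftTranslate (g : G) (v : E) :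
    maurerCartan E g (leftTranslate E g v) = v := by
  have h1 := (contMDiffAt_leftMul (E := E) g 1).mdifferentiableAt (by simp)
  have h2 := (contMDiffAt_leftMul (E := E) g⁻¹ (g * 1)).mdifferentiableAt (by simp)
  have h3 := mfderiv_comp (1 : G) h2 h1
  have h4 : (fun h : G => g⁻¹ * h) ∘ (fun h => g * h) = id := by ext; simp
  rw [h4, mfderiv_id] at h3
  -- The chain rule gives the derivative at `g * 1`. The type of `mfderiv` depends on the base
  -- point, so the point is replaced by substitution.
  have h6 : ∀ k : G, k = g →
      maurerCartan E g = mfderiv 𝓘(ℝ, E) 𝓘(ℝ, E) (fun h : G => g⁻¹ * h) k := by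
    rintro k rfl; rfl
  rw [h6 _ (mul_one g)]
  exact congrArg (fun T : E →L[ℝ] E => T v) h3.symm

theorem leftTranslate_maurerCartan (g : G) (v : E) :
    leftTranslate E g (maurerCartan E g v) = v := by
  have h1 := (contMDiffAt_leftMul (E := E) g⁻¹ g).mdifferentiableAt (by simp)
  have h2 := (contMDiffAt_leftMul (E := E) g (g⁻¹ * g)).mdifferentiableAt (by simp)
  have h3 := mfderiv_comp g h2 h1
  have h4 : (fun h : G => g * h) ∘ (fun h => g⁻¹ * h) = id := by ext; simp
  rw [h4, mfderiv_id] at h3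
  have h6 : ∀ k : G, k = 1 →
      leftTranslate E g = mfderiv 𝓘(ℝ, E) 𝓘(ℝ, E) (fun h : G => g * h) k := by
    rintro k rfl; rfl
  rw [h6 _ (inv_mul_cancel g)]
  exact congrArg (fun T : E →L[ℝ] E => T v) h3.symm

theorem chartMC_injective {e : OpenPartialHomeomorph G E}
    (he : e ∈ IsManifold.maximalAtlas 𝓘(ℝ, E) ∞ G) {x : E} (hx : x ∈ e.target) :
    Function.Injective (chartMC e x) := by
  intro v w h
  rw [← maurerCartan_modelDeriv_symm he hx, ← maurerCartan_modelDeriv_symm he hx] at h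
  exact modelDeriv_chart_symm_injective he hx
    (Function.LeftInverse.injective (leftTranslate_maurerCartan (e.symm x)) h)

variable [FiniteDimensional ℝ E]

theorem chartMC_isInvertible {e : OpenPartialHomeomorph G E}
    (he : e ∈ IsManifold.maximalAtlas 𝓘(ℝ, E) ∞ G) {x : E} (hx : x ∈ e.target) :
    (chartMC e x).IsInvertible :=
  ⟨(LinearEquiv.ofInjectiveEndo (chartMC e x).toLinearMap
    (chartMC_injective he hx)).toContinuousLinearEquiv, by ext v; rfl⟩

theorem chartMC_surjective {e : OpenPartialHomeomorph G E}
    (he : e ∈ IsManifold.maximalAtlas 𝓘(ℝ, E) ∞ G) {x : E} (hx : x ∈ e.target) :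
    Function.Surjective (chartMC e x) := by
  obtain ⟨f, hf⟩ := chartMC_isInvertible he hx
  rw [← hf]; exact f.surjective

end MaurerCartan

/-! ### Left-invariant fields in a chart and the Maurer-Cartan equation -/

section StructureEquation

open VectorField

variable {E : Type*} [NormedAddCommGroup E] [NormedSpace ℝ E] [FiniteDimensional ℝ E]
  {G : Type*} [TopologicalSpace G] [ChartedSpace E G] [Group G] [LieGroup 𝓘(ℝ, E) ∞ G]

/-- The left-invariant vector field with value `ζ` at the identity, in the chart `e`. -/
def chartInvariantField (e : OpenPartialHomeomorph G E) (ζ : E) (x : E) : E :=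
  (chartMC e x).inverse ζ

theorem chartMC_chartInvariantField {e : OpenPartialHomeomorph G E}
    (he : e ∈ IsManifold.maximalAtlas 𝓘(ℝ, E) ∞ G) {x : E} (hx : x ∈ e.target) (ζ : E) :
    chartMC e x (chartInvariantField e ζ x) = ζ :=
  (chartMC_isInvertible he hx).self_apply_inverse ζ

theorem chartInvariantField_chartMC {e : OpenPartialHomeomorph G E}
    (he : e ∈ IsManifold.maximalAtlas 𝓘(ℝ, E) ∞ G) {x : E} (hx : x ∈ e.target) (u : E) :
    chartInvariantField e (chartMC e x u) x = u :=
  (chartMC_isInvertible he hx).inverse_apply_self u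

theorem differentiableAt_chartInvariantField {e : OpenPartialHomeomorph G E}
    (he : e ∈ IsManifold.maximalAtlas 𝓘(ℝ, E) ∞ G) {x : E} (hx : x ∈ e.target) (ζ : E) :
    DifferentiableAt ℝ (chartInvariantField e ζ) x := by
  have : CompleteSpace E := FiniteDimensional.complete ℝ E
  obtain ⟨f, hf⟩ := chartMC_isInvertible he hx
  have h := contDiffAt_map_inverse (𝕜 := ℝ) (n := ∞) f
  rw [hf] at h
  have h1 := (h.comp x (contDiffAt_chartMC he hx)).differentiableAt (by simp)
  exact h1.clm_apply (differentiableAt_const ζ)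

/-- The injective map `chartMC e x` sends both vectors to `ζ`: on the left, the derivative of
`e.symm` undoes the pullback and the Maurer-Cartan form undoes the left translation. -/
theorem mpullback_mulInvariantVectorField_chart_symm {e : OpenPartialHomeomorph G E}
    (he : e ∈ IsManifold.maximalAtlas 𝓘(ℝ, E) ∞ G) {x : E} (hx : x ∈ e.target) (ζ : E) :
    (mpullback 𝓘(ℝ, E) 𝓘(ℝ, E) e.symm
      (mulInvariantVectorField (I := 𝓘(ℝ, E)) (G := G) ζ) x : E) = chartInvariantField e ζ x := by
  refine chartMC_injective he hx (Eq.trans ?_ (chartMC_chartInvariantField he hx ζ).symm)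
  refine (maurerCartan_modelDeriv_symm he hx _).symm.trans ?_
  have h := (modelDeriv_chart_symm_isInvertible he hx).self_apply_inverse
    (leftTranslate E (e.symm x) ζ)
  exact (congrArg (maurerCartan E (e.symm x)) h).trans (maurerCartan_leftTranslate _ ζ)

/-- The bracket of two left-invariant fields is the left-invariant field of the bracket, and
pullback by a chart commutes with Lie brackets. On the model space the manifold bracket is the
ordinary one. -/
theorem lieBracket_chartInvariantField {e : OpenPartialHomeomorph G E}
    (he : e ∈ IsManifold.maximalAtlas 𝓘(ℝ, E) ∞ G) {x : E} (hx : x ∈ e.target) (ζ θ : E) :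
    lieBracket ℝ (chartInvariantField e ζ) (chartInvariantField e θ) x =
      chartInvariantField e (lieBr G ζ θ) x := by
  have : CompleteSpace E := FiniteDimensional.complete ℝ E
  have : LieGroup 𝓘(ℝ, E) (minSmoothness ℝ 3) G :=
    LieGroup.of_le (n := ∞) (by simpa using (ENat.LEInfty.out : (3 : WithTop ℕ∞) ≤ ∞))
  have h := mpullback_mlieBracket (I := 𝓘(ℝ, E)) (I' := 𝓘(ℝ, E)) (f := e.symm) (x₀ := x) (n := ∞)
    (V := mulInvariantVectorField (I := 𝓘(ℝ, E)) (G := G) ζ)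
    (W := mulInvariantVectorField (I := 𝓘(ℝ, E)) (G := G) θ)
    (mdifferentiableAt_mulInvariantVectorField _) (mdifferentiableAt_mulInvariantVectorField _)
    (contMDiffAt_chart_symm he hx) (by simpa using (ENat.LEInfty.out : (2 : WithTop ℕ∞) ≤ ∞))
  have h0 := congrArg (fun X : (k : G) → TangentSpace 𝓘(ℝ, E) k =>
      (mpullback 𝓘(ℝ, E) 𝓘(ℝ, E) e.symm X x : E))
    (mulInvariantVector_mlieBracket (I := 𝓘(ℝ, E)) (G := G) ζ θ)
  have h1 := mpullback_mulInvariantVectorField_chart_symm he hx (lieBr G ζ θ)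
  have hev : ∀ κ : E, mpullback 𝓘(ℝ, E) 𝓘(ℝ, E) e.symm
      (mulInvariantVectorField (I := 𝓘(ℝ, E)) (G := G) κ) =ᶠ[𝓝 x] chartInvariantField e κ := by
    intro κ
    filter_upwards [e.open_target.mem_nhds hx] with y hy
      using mpullback_mulInvariantVectorField_chart_symm he hy κ
  have h2 := (hev ζ).mlieBracket_vectorField_eq (I := 𝓘(ℝ, E)) (hev θ)
  have h3 := congrFun (mlieBracketWithin_univ (I := 𝓘(ℝ, E)) (V := chartInvariantField e ζ)
    (W := chartInvariantField e θ)) x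
  have h4 := congrFun (mlieBracketWithin_eq_lieBracketWithin (𝕜 := ℝ) (s := Set.univ)
    (V := chartInvariantField e ζ) (W := chartInvariantField e θ)) x
  have h5 := congrFun (lieBracketWithin_univ (𝕜 := ℝ) (V := chartInvariantField e ζ)
    (W := chartInvariantField e θ)) x
  exact h5.symm.trans (h4.symm.trans (h3.trans (h2.symm.trans (h.symm.trans (h0.symm.trans h1)))))

/-- The Maurer-Cartan equation `dω(u, v) = -[ω u, ω v]`. -/
theorem maurerCartan_equation {e : OpenPartialHomeomorph G E}
    (he : e ∈ IsManifold.maximalAtlas 𝓘(ℝ, E) ∞ G) {x : E} (hx : x ∈ e.target) (u v : E) :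
    fderiv ℝ (chartMC e) x u v - fderiv ℝ (chartMC e) x v u =
      -lieBr G (chartMC e x u) (chartMC e x v) := by
  have hω := (contDiffAt_chartMC he hx).differentiableAt (by simp)
  -- Differentiating the constant `ω(X_ζ) = ζ`, with `X_ζ` the invariant field, trades derivatives
  -- of `ω` for derivatives of fields. With `ζ = ω u` and `ζ = ω v`, the left side of the claim
  -- becomes `-ω` of a Lie bracket.
  have key : ∀ ζ w : E, fderiv ℝ (chartMC e) x w (chartInvariantField e ζ x) +
      chartMC e x (fderiv ℝ (chartInvariantField e ζ) x w) = 0 := by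
    intro ζ w
    have h1 := hω.hasFDerivAt.clm_apply (differentiableAt_chartInvariantField he hx ζ).hasFDerivAt
    have h2 : (fun y => chartMC e y (chartInvariantField e ζ y)) =ᶠ[𝓝 x] fun _ => ζ := by
      filter_upwards [e.open_target.mem_nhds hx] with y hy
        using chartMC_chartInvariantField he hy ζ
    have h3 := (h1.congr_of_eventuallyEq h2.symm).unique (hasFDerivAt_const ζ x)
    have h4 := congrArg (fun T : E →L[ℝ] E => T w) h3
    simpa [add_comm] using h4
  have hb := lieBracket_chartInvariantField he hx (chartMC e x u) (chartMC e x v)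
  rw [lieBracket] at hb
  have hb' := congrArg (chartMC e x) hb
  rw [chartMC_chartInvariantField he hx, map_sub] at hb'
  have k1 := key (chartMC e x v) u
  have k2 := key (chartMC e x u) v
  simp only [chartInvariantField_chartMC he hx] at k1 k2 hb'
  rw [← hb', eq_neg_of_add_eq_zero_left k1, eq_neg_of_add_eq_zero_left k2]
  abel

end StructureEquation

/-! ### The infinitesimal action and the derivative of the orbit map -/

theorem dualAct_inv_eq {G V : Type*} [Group G] [NormedAddCommGroup V] [NormedSpace ℝ V]
    (ρ : G →* (V →L[ℝ] V)) (g : G) (A : StrongDual ℝ V) : dualAct ρ g⁻¹ A = A.comp (ρ g) := by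
  simp [dualAct]

section InfinitesimalAction

variable {E : Type*} [NormedAddCommGroup E] [NormedSpace ℝ E]
  {G : Type*} [TopologicalSpace G] [ChartedSpace E G]
  {W : Type*} [NormedAddCommGroup W] [NormedSpace ℝ W]

variable (E) in
/-- The derivative at `g` of a map from `G` to a vector space, as a map on the model space. -/
def vectorDeriv (F : G → W) (g : G) : E →L[ℝ] W :=
  mfderiv 𝓘(ℝ, E) 𝓘(ℝ, W) F g

theorem hasFDerivAt_comp_chart_symm {F : G → W} {g : G}
    (hF : MDifferentiableAt 𝓘(ℝ, E) 𝓘(ℝ, W) F g) :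
    HasFDerivAt (fun y => F ((chartAt E g).symm y)) (vectorDeriv E F g) (chartAt E g g) := by
  have h := hF.hasMFDerivAt.2
  rw [← hasFDerivWithinAt_univ]
  simp only [mfld_simps] at h
  exact h

variable [Group G] {V : Type*} [NormedAddCommGroup V] [NormedSpace ℝ V]

/-- The derivative at the identity of a representation, i.e. the induced representation of the
Lie algebra. -/
def repDeriv (ρ : G →* (V →L[ℝ] V)) : E →L[ℝ] V →L[ℝ] V :=
  vectorDeriv E ρ 1

theorem contMDiff_dualAct_inv {ρ : G →* (V →L[ℝ] V)}
    (hρ : ContMDiff 𝓘(ℝ, E) 𝓘(ℝ, V →L[ℝ] V) ∞ ρ)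
    (A : StrongDual ℝ V) :
    ContMDiff 𝓘(ℝ, E) 𝓘(ℝ, StrongDual ℝ V) ∞ (fun g : G => dualAct ρ g⁻¹ A) := by
  simp only [dualAct_inv_eq]
  exact (ContinuousLinearMap.compL ℝ V V ℝ A).contDiff.contMDiff.comp hρ

variable [LieGroup 𝓘(ℝ, E) ∞ G] {ρ : G →* (V →L[ℝ] V)}

/-- Differentiating `ρ(k⁻¹) ρ(k) = 1` at the identity shows that `k ↦ ρ(k⁻¹)` has derivative
`-repDeriv ρ` there. -/
theorem infAct_apply (hρ : ContMDiff 𝓘(ℝ, E) 𝓘(ℝ, V →L[ℝ] V) ∞ ρ) (b : StrongDual ℝ V) (ζ : E) :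
    infAct ρ b ζ = -(b.comp (repDeriv ρ ζ)) := by
  have hinv : ContMDiff 𝓘(ℝ, E) 𝓘(ℝ, V →L[ℝ] V) ∞ (fun k : G => ρ k⁻¹) :=
    hρ.comp (contMDiff_inv 𝓘(ℝ, E) ∞)
  have hact : ContMDiff 𝓘(ℝ, E) 𝓘(ℝ, StrongDual ℝ V) ∞ (fun k : G => dualAct ρ k b) :=
    (ContinuousLinearMap.compL ℝ V V ℝ b).contDiff.contMDiff.comp hinv
  have hr := hasFDerivAt_comp_chart_symm (hρ.mdifferentiable (by simp) (1 : G))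
  have hs := hasFDerivAt_comp_chart_symm (hinv.mdifferentiable (by simp) (1 : G))
  have ha := hasFDerivAt_comp_chart_symm (hact.mdifferentiable (by simp) (1 : G))
  have hb := ((ContinuousLinearMap.compL ℝ V V ℝ b).hasFDerivAt).comp _ hs
  have h1 := congrArg (fun T : E →L[ℝ] StrongDual ℝ V => T ζ) (ha.unique hb)
  have hm := hs.clm_comp hr
  have hc : (fun y => (ρ ((chartAt E (1 : G)).symm y)⁻¹).comp (ρ ((chartAt E (1 : G)).symm y))) =
      fun _ => 1 := by
    funext y; rw [← ContinuousLinearMap.mul_def, ← map_mul, inv_mul_cancel, map_one]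
  rw [hc] at hm
  have h2 := congrArg (fun T : E →L[ℝ] V →L[ℝ] V => T ζ)
    ((hasFDerivAt_const (1 : V →L[ℝ] V) (chartAt E (1 : G) 1)).unique hm)
  have h3 : vectorDeriv E (fun k : G => ρ k⁻¹) 1 ζ = -repDeriv ρ ζ := by
    rw [eq_neg_iff_add_eq_zero, add_comm]
    ext v
    simpa [(chartAt E (1 : G)).left_inv (mem_chart_source E (1 : G)), repDeriv] using
      (congrArg (fun T : V →L[ℝ] V => T v) h2).symm
  refine h1.trans ?_
  ext v
  simp [h3]

/-- With `g = e.symm x`, one has `A ∘ ρ(h) = (g⁻¹ A) ∘ ρ(g⁻¹ h)`. This moves the differentiation to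
the identity, where `infAct_apply` identifies the derivative; the inner derivative is the
Maurer-Cartan form. -/
theorem hasFDerivAt_rep_chart_symm (hρ : ContMDiff 𝓘(ℝ, E) 𝓘(ℝ, V →L[ℝ] V) ∞ ρ)
    {e : OpenPartialHomeomorph G E} (he : e ∈ IsManifold.maximalAtlas 𝓘(ℝ, E) ∞ G) {x : E}
    (hx : x ∈ e.target) (A : StrongDual ℝ V) :
    HasFDerivAt (fun y => dualAct ρ (e.symm y)⁻¹ A)
      (-(infAct ρ (dualAct ρ (e.symm x)⁻¹ A)).comp (chartMC e x)) x := by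
  have h1 := contMDiffAt_chart_symm he hx
  have h2 : ContMDiffAt 𝓘(ℝ, E) 𝓘(ℝ, E) ∞ (fun y => (e.symm x)⁻¹ * e.symm y) x :=
    contMDiffAt_const.mul h1
  have h3 : ContMDiffAt 𝓘(ℝ, E) 𝓘(ℝ, E) ∞ (chartAt E (1 : G)) ((e.symm x)⁻¹ * e.symm x) := by
    rw [inv_mul_cancel]
    exact contMDiffAt_chart (IsManifold.chart_mem_maximalAtlas 1) (mem_chart_source E 1)
  have h4 : ContDiffAt ℝ ∞ (fun y => chartAt E (1 : G) ((e.symm x)⁻¹ * e.symm y)) x :=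
    (ContMDiffAt.comp x (g := chartAt E (1 : G)) h3 h2).contDiffAt
  have h5 : HasFDerivAt (fun y => chartAt E (1 : G) ((e.symm x)⁻¹ * e.symm y)) (chartMC e x) x :=
    (h4.differentiableAt (by simp)).hasFDerivAt
  have hr : HasFDerivAt (fun y => ρ ((chartAt E (1 : G)).symm y)) (repDeriv ρ)
      (chartAt E (1 : G) ((e.symm x)⁻¹ * e.symm x)) := by
    rw [inv_mul_cancel]
    exact hasFDerivAt_comp_chart_symm (hρ.mdifferentiable (by simp) (1 : G))
  have h6 := hr.comp x h5
  have h7 := (ContinuousLinearMap.compL ℝ V V ℝ (dualAct ρ (e.symm x)⁻¹ A)).hasFDerivAt.comp x h6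
  have hev : ∀ᶠ y in 𝓝 x, (e.symm x)⁻¹ * e.symm y ∈ (chartAt E (1 : G)).source := by
    refine h2.continuousAt.eventually_mem ((chartAt E (1 : G)).open_source.mem_nhds ?_)
    rw [inv_mul_cancel]; exact mem_chart_source E 1
  have h8 := h7.congr_of_eventuallyEq (f₁ := fun y => dualAct ρ (e.symm y)⁻¹ A) (by
    filter_upwards [hev] with y hy
    ext v
    have hk : ∀ w, ρ (e.symm x) (ρ (e.symm x)⁻¹ w) = w := fun w =>
      congrArg (fun T : V →L[ℝ] V => T w)
        (show ρ (e.symm x) * ρ (e.symm x)⁻¹ = 1 by rw [← map_mul, mul_inv_cancel, map_one])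
    simp [dualAct, (chartAt E (1 : G)).left_inv hy, hk])
  refine h8.congr_fderiv ?_
  ext u
  simp [infAct_apply hρ]

end InfinitesimalAction

/-! ### The body velocity of a curve in a chart -/

section BodyVelocity

variable {E : Type*} [NormedAddCommGroup E] [NormedSpace ℝ E]
  {G : Type*} [TopologicalSpace G] [ChartedSpace E G]

theorem tangentLift_eq_modelDeriv {e : OpenPartialHomeomorph G E}
    (he : e ∈ IsManifold.maximalAtlas 𝓘(ℝ, E) ∞ G) {c : ℝ → G} {I : Set ℝ} {t : ℝ} {v : E}
    (hI : UniqueDiffWithinAt ℝ I t) (hc : ContinuousWithinAt c I t)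
    (hs : c t ∈ e.source) (hv : HasDerivWithinAt (fun s => e (c s)) v I t) :
    ((tangentLift (E := E) I c t).2 : E) = modelDeriv e.symm (e (c t)) v := by
  have h1 := ((contMDiffAt_chart_symm he (e.map_source hs)).mdifferentiableAt
    (by simp)).hasMFDerivAt
  have h2 := hv.hasFDerivWithinAt.hasMFDerivWithinAt
  have h3 := HasMFDerivAt.comp_hasMFDerivWithinAt t (f := fun s => e (c s)) h1 h2
  have hev : c =ᶠ[𝓝[I] t] e.symm ∘ (fun s => e (c s)) := by
    filter_upwards [hc.eventually_mem (e.open_source.mem_nhds hs)] with s hs'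
      using (e.left_inv hs').symm
  have h4 := h3.congr_of_eventuallyEq hev (e.left_inv hs).symm
  have h5 := h4.mfderivWithin hI.uniqueMDiffWithinAt
  have h6 := congrArg (fun T : ℝ →L[ℝ] E => T 1) h5
  refine h6.trans ?_
  have h7 : (ContinuousLinearMap.toSpanSingleton ℝ v) 1 = v := by simp
  exact congrArg (modelDeriv e.symm (e (c t))) h7

variable [Group G] [LieGroup 𝓘(ℝ, E) ∞ G]

theorem bodyVelocity_eq_chartMC {e : OpenPartialHomeomorph G E}
    (he : e ∈ IsManifold.maximalAtlas 𝓘(ℝ, E) ∞ G) {c : ℝ → G} {I : Set ℝ} {t : ℝ} {v : E}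
    (hI : UniqueDiffWithinAt ℝ I t) (hc : ContinuousWithinAt c I t)
    (hs : c t ∈ e.source) (hv : HasDerivWithinAt (fun s => e (c s)) v I t) :
    bodyVelocity I c t = chartMC e (e (c t)) v := by
  rw [← maurerCartan_modelDeriv_symm he (e.map_source hs), e.left_inv hs,
    ← tangentLift_eq_modelDeriv he hI hc hs hv]
  rfl

end BodyVelocity

/-! ### Partial derivatives on a product of intervals -/

section Slices

variable {W : Type*} [NormedAddCommGroup W] [NormedSpace ℝ W]

theorem hasDerivWithinAt_slice_right {f : ℝ × ℝ → W} {f' : ℝ × ℝ →L[ℝ] W} {I J : Set ℝ}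
    {p : ℝ × ℝ} (hp : p ∈ I ×ˢ J) (hf : HasFDerivWithinAt f f' (I ×ˢ J) p) :
    HasDerivWithinAt (fun s => f (p.1, s)) (f' (0, 1)) J p.2 :=
  hf.comp_hasDerivWithinAt (f := fun s => (p.1, s)) p.2
    ((hasDerivWithinAt_const p.2 J p.1).prodMk (hasDerivWithinAt_id p.2 J))
    (fun _ hs => ⟨hp.1, hs⟩)

theorem hasDerivWithinAt_slice_left {f : ℝ × ℝ → W} {f' : ℝ × ℝ →L[ℝ] W} {I J : Set ℝ}
    {p : ℝ × ℝ} (hp : p ∈ I ×ˢ J) (hf : HasFDerivWithinAt f f' (I ×ˢ J) p) :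
    HasDerivWithinAt (fun s => f (s, p.2)) (f' (1, 0)) I p.1 :=
  hf.comp_hasDerivWithinAt (f := fun s => (s, p.2)) p.1
    ((hasDerivWithinAt_id p.1 I).prodMk (hasDerivWithinAt_const p.1 I p.2))
    (fun _ hs => ⟨hs, hp.2⟩)

end Slices

/-! ### Two-parameter families of curves and the variation of the body velocity -/

section Families

variable {E : Type*} [NormedAddCommGroup E] [NormedSpace ℝ E]
  {G : Type*} [TopologicalSpace G] [ChartedSpace E G]
  {I J : Set ℝ} {c : ℝ × ℝ → G}

theorem contDiffWithinAt_chart_comp (hc : ContMDiffOn 𝓘(ℝ, ℝ × ℝ) 𝓘(ℝ, E) ∞ c (I ×ˢ J))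
    {e : OpenPartialHomeomorph G E} (he : e ∈ IsManifold.maximalAtlas 𝓘(ℝ, E) ∞ G)
    {p : ℝ × ℝ} (hp : p ∈ I ×ˢ J) (hs : c p ∈ e.source) :
    ContDiffWithinAt ℝ ∞ (fun q => e (c q)) (I ×ˢ J) p :=
  (ContMDiffAt.comp_contMDiffWithinAt p (contMDiffAt_chart he hs) (hc p hp)).contDiffWithinAt

variable [Group G] [LieGroup 𝓘(ℝ, E) ∞ G]

theorem bodyVelocity_slice_right (hJ : UniqueDiffOn ℝ J)
    (hc : ContMDiffOn 𝓘(ℝ, ℝ × ℝ) 𝓘(ℝ, E) ∞ c (I ×ˢ J))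
    {e : OpenPartialHomeomorph G E} (he : e ∈ IsManifold.maximalAtlas 𝓘(ℝ, E) ∞ G)
    {p : ℝ × ℝ} (hp : p ∈ I ×ˢ J) (hs : c p ∈ e.source) :
    bodyVelocity J (fun s => c (p.1, s)) p.2 =
      chartMC e (e (c p)) (fderivWithin ℝ (fun q => e (c q)) (I ×ˢ J) p (0, 1)) := by
  have h := ((contDiffWithinAt_chart_comp hc he hp hs).differentiableWithinAt
    (by simp)).hasFDerivWithinAt
  refine bodyVelocity_eq_chartMC he (c := fun s => c (p.1, s)) (hJ _ hp.2) ?_ hs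
    (hasDerivWithinAt_slice_right hp h)
  exact ContinuousWithinAt.comp (f := fun s => (p.1, s)) (hc p hp).continuousWithinAt
    (by fun_prop) (fun s hs => ⟨hp.1, hs⟩)

theorem bodyVelocity_slice_left (hI : UniqueDiffOn ℝ I)
    (hc : ContMDiffOn 𝓘(ℝ, ℝ × ℝ) 𝓘(ℝ, E) ∞ c (I ×ˢ J))
    {e : OpenPartialHomeomorph G E} (he : e ∈ IsManifold.maximalAtlas 𝓘(ℝ, E) ∞ G)
    {p : ℝ × ℝ} (hp : p ∈ I ×ˢ J) (hs : c p ∈ e.source) :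
    bodyVelocity I (fun s => c (s, p.2)) p.1 =
      chartMC e (e (c p)) (fderivWithin ℝ (fun q => e (c q)) (I ×ˢ J) p (1, 0)) := by
  have h := ((contDiffWithinAt_chart_comp hc he hp hs).differentiableWithinAt
    (by simp)).hasFDerivWithinAt
  refine bodyVelocity_eq_chartMC he (c := fun s => c (s, p.2)) (hI _ hp.1) ?_ hs
    (hasDerivWithinAt_slice_left hp h)
  exact ContinuousWithinAt.comp (f := fun s => (s, p.2)) (hc p hp).continuousWithinAt
    (by fun_prop) (fun s hs => ⟨hs, hp.2⟩)

omit [Group G] [LieGroup 𝓘(ℝ, E) ∞ G] in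
theorem eventually_mem_chart_source (hc : ContMDiffOn 𝓘(ℝ, ℝ × ℝ) 𝓘(ℝ, E) ∞ c (I ×ˢ J))
    {e : OpenPartialHomeomorph G E} {p : ℝ × ℝ} (hp : p ∈ I ×ˢ J) (hs : c p ∈ e.source) :
    ∀ᶠ q in 𝓝[I ×ˢ J] p, q ∈ I ×ˢ J ∧ c q ∈ e.source := by
  filter_upwards [(hc p hp).continuousWithinAt.eventually_mem (e.open_source.mem_nhds hs),
    self_mem_nhdsWithin] with q h1 h2 using ⟨h2, h1⟩

theorem contDiffWithinAt_chartMC_fderivWithin (hI : UniqueDiffOn ℝ I) (hJ : UniqueDiffOn ℝ J)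
    (hc : ContMDiffOn 𝓘(ℝ, ℝ × ℝ) 𝓘(ℝ, E) ∞ c (I ×ˢ J))
    {e : OpenPartialHomeomorph G E} (he : e ∈ IsManifold.maximalAtlas 𝓘(ℝ, E) ∞ G)
    {p : ℝ × ℝ} (hp : p ∈ I ×ˢ J) (hs : c p ∈ e.source) (w : ℝ × ℝ) :
    ContDiffWithinAt ℝ ∞ (fun q => chartMC e (e (c q))
      (fderivWithin ℝ (fun q => e (c q)) (I ×ˢ J) q w)) (I ×ˢ J) p := by
  have hx := contDiffWithinAt_chart_comp hc he hp hs
  have h1 := (contDiffAt_chartMC he (e.map_source hs)).comp_contDiffWithinAt p hx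
  have h2 := hx.fderivWithin_right (m := ∞) (hI.prod hJ) (by simp) hp
  exact h1.clm_apply (h2.clm_apply contDiffWithinAt_const)

theorem contDiffOn_bodyVelocity_right (hI : UniqueDiffOn ℝ I) (hJ : UniqueDiffOn ℝ J)
    (hc : ContMDiffOn 𝓘(ℝ, ℝ × ℝ) 𝓘(ℝ, E) ∞ c (I ×ˢ J)) :
    ContDiffOn ℝ ∞ (fun p : ℝ × ℝ => (bodyVelocity J (fun s => c (p.1, s)) p.2 : E))
      (I ×ˢ J) := by
  intro p hp
  have he := IsManifold.chart_mem_maximalAtlas (I := 𝓘(ℝ, E)) (n := ∞) (c p)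
  have hs := mem_chart_source E (c p)
  refine (contDiffWithinAt_chartMC_fderivWithin hI hJ hc he hp hs (0, 1)).congr_of_eventuallyEq
    ?_ (bodyVelocity_slice_right hJ hc he hp hs)
  filter_upwards [eventually_mem_chart_source hc hp hs] with q hq
    using bodyVelocity_slice_right hJ hc he hq.1 hq.2

theorem contDiffOn_bodyVelocity_left (hI : UniqueDiffOn ℝ I) (hJ : UniqueDiffOn ℝ J)
    (hc : ContMDiffOn 𝓘(ℝ, ℝ × ℝ) 𝓘(ℝ, E) ∞ c (I ×ˢ J)) :
    ContDiffOn ℝ ∞ (fun p : ℝ × ℝ => (bodyVelocity I (fun s => c (s, p.2)) p.1 : E))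
      (I ×ˢ J) := by
  intro p hp
  have he := IsManifold.chart_mem_maximalAtlas (I := 𝓘(ℝ, E)) (n := ∞) (c p)
  have hs := mem_chart_source E (c p)
  refine (contDiffWithinAt_chartMC_fderivWithin hI hJ hc he hp hs (1, 0)).congr_of_eventuallyEq
    ?_ (bodyVelocity_slice_left hI hc he hp hs)
  filter_upwards [eventually_mem_chart_source hc hp hs] with q hq
    using bodyVelocity_slice_left hI hc he hq.1 hq.2

variable [FiniteDimensional ℝ E]

/-- The variation of the body velocity: `δξ = η̇ + [ξ, η]`. -/
theorem hasDerivWithinAt_bodyVelocity (hI : UniqueDiffOn ℝ I) (hJ : UniqueDiffOn ℝ J)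
    (hc : ContMDiffOn 𝓘(ℝ, ℝ × ℝ) 𝓘(ℝ, E) ∞ c (I ×ˢ J)) {p : ℝ × ℝ} (hp : p ∈ I ×ˢ J)
    (hcl : p ∈ closure (interior (I ×ˢ J))) :
    HasDerivWithinAt (fun ε => (bodyVelocity J (fun s => c (ε, s)) p.2 : E))
      (derivWithin (fun s => bodyVelocity I (fun ε => c (ε, s)) p.1) J p.2 +
        lieBr G (bodyVelocity J (fun s => c (p.1, s)) p.2)
          (bodyVelocity I (fun ε => c (ε, p.2)) p.1)) I p.1 := by
  have he := IsManifold.chart_mem_maximalAtlas (I := 𝓘(ℝ, E)) (n := ∞) (c p)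
  have hs := mem_chart_source E (c p)
  set e := chartAt E (c p)
  set x : ℝ × ℝ → E := fun q => e (c q) with hxdef
  set S := I ×ˢ J
  have hS : UniqueDiffOn ℝ S := hI.prod hJ
  have hx : ContDiffWithinAt ℝ ∞ x S p := contDiffWithinAt_chart_comp hc he hp hs
  have hD := ((hx.fderivWithin_right (m := ∞) hS (by simp) hp).differentiableWithinAt
    (by simp)).hasFDerivWithinAt
  have hω := ((contDiffAt_chartMC he (e.map_source hs)).differentiableAt (by simp)).hasFDerivAt
  have hx' := (hx.differentiableWithinAt (by simp)).hasFDerivWithinAt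
  have hcomp := hω.comp_hasFDerivWithinAt (f := x) p hx'
  -- Product rule for `ω(x)(∂_w x)`. Each partial derivative consists of a term with a derivative of
  -- `ω` and a term with a second derivative of `x`.
  have key : ∀ w, HasFDerivWithinAt (fun q => chartMC e (x q) (fderivWithin ℝ x S q w)) _ S p :=
    fun w => hcomp.clm_apply (hD.clm_apply (hasFDerivWithinAt_const w p S))
  have hr := hasDerivWithinAt_slice_left hp (key (0, 1))
  have hl := hasDerivWithinAt_slice_right hp (key (1, 0))
  have hev := eventually_mem_chart_source hc hp hs
  have hr' := hr.congr_of_eventuallyEq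
    (f₁ := fun ε => (bodyVelocity J (fun s => c (ε, s)) p.2 : E)) (by
      have ht : Filter.Tendsto (fun ε : ℝ => (ε, p.2)) (𝓝[I] p.1) (𝓝[S] p) :=
        tendsto_nhdsWithin_of_tendsto_nhds_of_eventually_within _
          ((by fun_prop : Continuous fun ε : ℝ => (ε, p.2)).tendsto _ |>.mono_left
            nhdsWithin_le_nhds) (by
          filter_upwards [self_mem_nhdsWithin] with ε hε using ⟨hε, hp.2⟩)
      filter_upwards [ht.eventually hev] with ε hε
        using bodyVelocity_slice_right hJ hc he hε.1 hε.2)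
    (bodyVelocity_slice_right hJ hc he hp hs)
  have hl' := hl.congr_of_eventuallyEq
    (f₁ := fun s => (bodyVelocity I (fun ε => c (ε, s)) p.1 : E)) (by
      have ht : Filter.Tendsto (fun s : ℝ => (p.1, s)) (𝓝[J] p.2) (𝓝[S] p) :=
        tendsto_nhdsWithin_of_tendsto_nhds_of_eventually_within _
          ((by fun_prop : Continuous fun s : ℝ => (p.1, s)).tendsto _ |>.mono_left
            nhdsWithin_le_nhds) (by
          filter_upwards [self_mem_nhdsWithin] with s hs using ⟨hp.1, hs⟩)
      filter_upwards [ht.eventually hev] with s hs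
        using bodyVelocity_slice_left hI hc he hs.1 hs.2)
    (bodyVelocity_slice_left hI hc he hp hs)
  refine hr'.congr_deriv ?_
  rw [hl'.derivWithin (hJ _ hp.2), bodyVelocity_slice_right hJ hc he hp hs,
    bodyVelocity_slice_left hI hc he hp hs]
  -- The mixed second derivatives agree also at boundary points, because `p` lies in the closure of
  -- the interior. They cancel, and the remaining antisymmetric derivative of `ω` is the bracket.
  have hsymm := (hx.isSymmSndFDerivWithinAt
    (by simpa using (ENat.LEInfty.out : (2 : WithTop ℕ∞) ≤ ∞)) hS hcl hp) (1, 0) (0, 1)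
  have hMC := maurerCartan_equation he (e.map_source hs)
    (fderivWithin ℝ x S p (1, 0)) (fderivWithin ℝ x S p (0, 1))
  rw [lieBr_swap, neg_neg] at hMC
  rw [← hMC]
  simp [hsymm]

end Families

/-- The interaction part of the Lagrangian depends on the reduced advected variables only. -/
theorem interactionEnergy_eq_one {G V : Type*} [Group G]
    [NormedAddCommGroup V] [NormedSpace ℝ V] {N : ℕ} (𝒩 : SimpleGraph (Fin N)) [DecidableRel 𝒩.Adj]
    (ρ : G →* (V →L[ℝ] V)) (J : Fin N → Fin N → StrongDual ℝ V →L[ℝ] V) (i j : Fin N)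
    (g₁ g₂ : G) (A₁ A₂ : StrongDual ℝ V) :
    interactionEnergy 𝒩 ρ J i j g₁ g₂ A₁ A₂ =
      interactionEnergy 𝒩 ρ J i j 1 1 (dualAct ρ g₁⁻¹ A₁) (dualAct ρ g₂⁻¹ A₂) := by
  have h : ∀ b : StrongDual ℝ V, dualAct ρ (1 : G)⁻¹ b = b := by
    intro b; ext v; simp [dualAct]
  simp only [interactionEnergy, h]

/-! ### Reduction of the Lagrangian by left translation -/

section Reduction

variable {E : Type*} [NormedAddCommGroup E] [NormedSpace ℝ E]
  {G : Type*} [TopologicalSpace G] [ChartedSpace E G] [Group G]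
  {V : Type*} [NormedAddCommGroup V] [NormedSpace ℝ V] {N : ℕ}

theorem tangentMap_inv_mul (k : G) (v : E) :
    tangentMap 𝓘(ℝ, E) 𝓘(ℝ, E) (fun h : G => k⁻¹ * h) ⟨k, v⟩ = atOne G (maurerCartan E k v) := by
  have h : ∀ h : G, h = 1 → ∀ w : E, (⟨h, w⟩ : TangentBundle 𝓘(ℝ, E) G) = atOne G w := by
    rintro h rfl w; rfl
  exact h _ (inv_mul_cancel k) _

variable (𝒩 : SimpleGraph (Fin N)) [DecidableRel 𝒩.Adj] (ρ : G →* (V →L[ℝ] V))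
  (J : Fin N → Fin N → StrongDual ℝ V →L[ℝ] V)
  (L : Fin N → TangentBundle 𝓘(ℝ, E) G → StrongDual ℝ V → ℝ)

/-- Each node may be translated by its own group element: `hinv` is applied at node `i` with `h =
g_i⁻¹`, and the interaction depends on the `g_i⁻¹ A_i` alone. -/
theorem fullLagrangian_eq_reduced
    (hinv : ∀ (i : Fin N) (h : G) (p : TangentBundle 𝓘(ℝ, E) G) (a : StrongDual ℝ V),
      L i (tangentMap 𝓘(ℝ, E) 𝓘(ℝ, E) (fun k : G => h * k) p) (dualAct ρ h a) = L i p a)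
    (p : Fin N → TangentBundle 𝓘(ℝ, E) G) (A : Fin N → StrongDual ℝ V) :
    fullLagrangian 𝒩 ρ J L p A = reducedLagrangian 𝒩 ρ J L
      (fun i => maurerCartan E (p i).proj (p i).2) (fun i => dualAct ρ (p i).proj⁻¹ (A i)) := by
  have h1 : ∀ i, L i (p i) (A i) = L i (atOne G (maurerCartan E (p i).proj (p i).2))
      (dualAct ρ (p i).proj⁻¹ (A i)) := fun i => by
    rw [← hinv i (p i).proj⁻¹ (p i) (A i)]
    exact congrArg (fun q => L i q (dualAct ρ (p i).proj⁻¹ (A i)))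
      (tangentMap_inv_mul (E := E) (p i).proj (p i).2)
  simp only [reducedLagrangian, fullLagrangian, h1]
  congr 1
  exact Finset.sum_congr rfl fun i _ => Finset.sum_congr rfl fun j _ =>
    interactionEnergy_eq_one 𝒩 ρ J i j _ _ _ _

variable {L} [LieGroup 𝓘(ℝ, E) ∞ G]

/-- In the trivialization of `TG` at the identity the fibre coordinate of `atOne G ζ` is `ζ` itself,
since the coordinate change of the chart at `1` with itself is trivial. -/
theorem contMDiff_atOne :
    ContMDiff 𝓘(ℝ, E) 𝓘(ℝ, E).tangent ∞ (atOne G : E → TangentBundle 𝓘(ℝ, E) G) := by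
  intro ζ
  rw [Bundle.contMDiffAt_totalSpace]
  refine ⟨contMDiffAt_const, ?_⟩
  have h : (fun θ : E => (trivializationAt E (TangentSpace 𝓘(ℝ, E) : G → Type _) (1 : G)
      (atOne G θ)).2) = fun θ => θ := by
    funext θ
    have hev : chartAt E (1 : G) ∘ (chartAt E (1 : G)).symm =ᶠ[𝓝 (chartAt E (1 : G) 1)] id := by
      filter_upwards [(chartAt E (1 : G)).open_target.mem_nhds
        (mem_chart_target E (1 : G))] with y hy using (chartAt E (1 : G)).right_inv hy
    simp [atOne, TangentBundle.trivializationAt_apply, hev.fderiv_eq]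
  exact (congrArg (fun f : E → E => ContMDiffAt 𝓘(ℝ, E) 𝓘(ℝ, E) ∞ f ζ) h).mpr contMDiffAt_id

theorem contDiff_nodeReduced
    (hL : ∀ i, ContMDiff (𝓘(ℝ, E).tangent.prod 𝓘(ℝ, StrongDual ℝ V)) 𝓘(ℝ, ℝ) ∞
      (fun q : TangentBundle 𝓘(ℝ, E) G × StrongDual ℝ V => L i q.1 q.2)) (i : Fin N) :
    ContDiff ℝ ∞ (fun p : E × StrongDual ℝ V => nodeReduced L i p.1 p.2) := by
  have h : ContMDiff 𝓘(ℝ, E × StrongDual ℝ V) (𝓘(ℝ, E).tangent.prod 𝓘(ℝ, StrongDual ℝ V)) ∞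
      (fun p : E × StrongDual ℝ V => (atOne G p.1, p.2)) :=
    (contMDiff_atOne.comp contDiff_fst.contMDiff).prodMk contDiff_snd.contMDiff
  exact ((hL i).comp h).contDiff

end Reduction

/-! ### The derivative of the reduced Lagrangian and the Euler-Poincaré force -/

section Derivative

variable {E : Type*} [NormedAddCommGroup E] [NormedSpace ℝ E]
  {V : Type*} [NormedAddCommGroup V] [NormedSpace ℝ V] {N : ℕ}

theorem fderiv_partial_add {F : E × V → ℝ} {x : E} {y : V} (hF : DifferentiableAt ℝ F (x, y))
    (u : E) (w : V) :
    fderiv ℝ F (x, y) (u, w) =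
      fderiv ℝ (fun z => F (z, y)) x u + fderiv ℝ (fun z => F (x, z)) y w := by
  have h1 : HasFDerivAt (fun z => F (z, y)) _ x :=
    hF.hasFDerivAt.comp x (hasFDerivAt_prodMk_left x y)
  have h2 : HasFDerivAt (fun z => F (x, z)) _ y :=
    hF.hasFDerivAt.comp y (hasFDerivAt_prodMk_right x y)
  rw [h1.fderiv, h2.fderiv]
  simp [← map_add]

variable (𝒩 : SimpleGraph (Fin N)) [DecidableRel 𝒩.Adj]
  (J : Fin N → Fin N → StrongDual ℝ V →L[ℝ] V)

/-- The coupling term as a linear function of the advected variables. -/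
def couplingCLM (i : Fin N) : (Fin N → StrongDual ℝ V) →L[ℝ] V :=
  ∑ j ∈ 𝒩.neighborFinset i, (1 / √((𝒩.degree i : ℝ) * 𝒩.degree j)) •
    (J i j).comp (ContinuousLinearMap.proj j)

theorem couplingCLM_apply (a : Fin N → StrongDual ℝ V) (i : Fin N) :
    couplingCLM 𝒩 J i a = coupling 𝒩 J a i := by
  simp [couplingCLM, coupling]

/-- Exchanging the two ends of each edge turns one sum into the other. Hence the coupling operator
is symmetric, and the quadratic form `(1/2) ⟨a, C a⟩` has derivative `b ↦ ⟨b, C a⟩`. -/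
theorem sum_apply_coupling_comm
    (hJ : ∀ i j, 𝒩.Adj i j → ∀ a b : StrongDual ℝ V, a (J i j b) = b (J j i a))
    (a b : Fin N → StrongDual ℝ V) :
    ∑ i, a i (coupling 𝒩 J b i) = ∑ i, b i (coupling 𝒩 J a i) := by
  simp only [coupling, map_sum, map_smul, smul_eq_mul]
  rw [Finset.sum_comm' (t' := Finset.univ) (s' := fun j => 𝒩.neighborFinset j)
    (by intro i j; simp [𝒩.adj_comm])]
  refine Finset.sum_congr rfl fun i _ => Finset.sum_congr rfl fun j hj => ?_
  rw [hJ j i ((𝒩.mem_neighborFinset i j).1 hj).symm, mul_comm (𝒩.degree j : ℝ)]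

variable {G : Type*} [TopologicalSpace G] [ChartedSpace E G] [Group G]
  (ρ : G →* (V →L[ℝ] V)) {L : Fin N → TangentBundle 𝓘(ℝ, E) G → StrongDual ℝ V → ℝ}

theorem contDiff_reducedLagrangian
    (hl : ∀ i, ContDiff ℝ ∞ (fun p : E × StrongDual ℝ V => nodeReduced L i p.1 p.2)) :
    ContDiff ℝ ∞ (fun p : (Fin N → E) × (Fin N → StrongDual ℝ V) =>
      reducedLagrangian 𝒩 ρ J L p.1 p.2) := by
  simp only [reducedLagrangian_eq, ← couplingCLM_apply]
  refine (ContDiff.sum fun i _ => ?_).add (contDiff_const.mul (ContDiff.sum fun i _ => ?_))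
  · exact (hl i).comp (((contDiff_apply ℝ E i).comp contDiff_fst).prodMk
      ((contDiff_apply ℝ (StrongDual ℝ V) i).comp contDiff_snd))
  · exact ((contDiff_apply ℝ (StrongDual ℝ V) i).comp contDiff_snd).clm_apply
      ((couplingCLM 𝒩 J i).contDiff.comp contDiff_snd)

theorem contDiff_momentum
    (hl : ∀ i, ContDiff ℝ ∞ (fun p : E × StrongDual ℝ V => nodeReduced L i p.1 p.2)) (i : Fin N) :
    ContDiff ℝ ∞ (fun p : E × StrongDual ℝ V =>
      fderiv ℝ (fun ζ => nodeReduced L i ζ p.2) p.1) := by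
  refine ContDiff.fderiv (f := fun (p : E × StrongDual ℝ V) ζ => nodeReduced L i ζ p.2)
    (n := ∞) (m := ∞) ?_ contDiff_fst (by simp)
  exact (hl i).comp (contDiff_snd.prodMk (contDiff_snd.comp contDiff_fst))

theorem contDiff_fderiv_advected
    (hl : ∀ i, ContDiff ℝ ∞ (fun p : E × StrongDual ℝ V => nodeReduced L i p.1 p.2)) (i : Fin N) :
    ContDiff ℝ ∞ (fun p : E × StrongDual ℝ V =>
      fderiv ℝ (fun b => nodeReduced L i p.1 b) p.2) := by
  refine ContDiff.fderiv (f := fun (p : E × StrongDual ℝ V) b => nodeReduced L i p.1 b)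
    (n := ∞) (m := ∞) ?_ contDiff_snd (by simp)
  exact (hl i).comp ((contDiff_fst.comp contDiff_fst).prodMk contDiff_snd)

variable [FiniteDimensional ℝ V]

variable (L) in
/-- The derivative of the reduced Lagrangian. -/
def reducedDeriv (ξ : Fin N → E) (a : Fin N → StrongDual ℝ V) :
    (Fin N → E) × (Fin N → StrongDual ℝ V) →L[ℝ] ℝ :=
  ∑ i, ((fderiv ℝ (fun ζ => nodeReduced L i ζ (a i)) (ξ i)).comp
      ((ContinuousLinearMap.proj i).comp (ContinuousLinearMap.fst ℝ _ _)) +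
    (NormedSpace.inclusionInDoubleDual ℝ V (varDeriv (fun b => nodeReduced L i (ξ i) b) (a i) +
      coupling 𝒩 J a i)).comp
      ((ContinuousLinearMap.proj i).comp (ContinuousLinearMap.snd ℝ _ _)))

theorem reducedDeriv_apply (ξ : Fin N → E) (a : Fin N → StrongDual ℝ V) (u : Fin N → E)
    (b : Fin N → StrongDual ℝ V) :
    reducedDeriv 𝒩 J L ξ a (u, b) =
      ∑ i, (fderiv ℝ (fun ζ => nodeReduced L i ζ (a i)) (ξ i) (u i) +
        b i (varDeriv (fun b => nodeReduced L i (ξ i) b) (a i) + coupling 𝒩 J a i)) := by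
  simp [reducedDeriv]

theorem hasFDerivAt_reducedLagrangian
    (hJ : ∀ i j, 𝒩.Adj i j → ∀ a b : StrongDual ℝ V, a (J i j b) = b (J j i a))
    (hl : ∀ i, ContDiff ℝ ∞ (fun p : E × StrongDual ℝ V => nodeReduced L i p.1 p.2))
    (ξ : Fin N → E) (a : Fin N → StrongDual ℝ V) :
    HasFDerivAt (fun p : (Fin N → E) × (Fin N → StrongDual ℝ V) =>
      reducedLagrangian 𝒩 ρ J L p.1 p.2) (reducedDeriv 𝒩 J L ξ a) (ξ, a) := by
  simp only [reducedLagrangian_eq]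
  have h1 : ∀ i, HasFDerivAt (fun p : (Fin N → E) × (Fin N → StrongDual ℝ V) =>
      nodeReduced L i (p.1 i) (p.2 i)) _ (ξ, a) := fun i =>
    HasFDerivAt.comp (g := fun p : E × StrongDual ℝ V => nodeReduced L i p.1 p.2) (ξ, a)
      ((hl i).differentiable (by simp) (ξ i, a i)).hasFDerivAt
      (((ContinuousLinearMap.proj (R := ℝ) (φ := fun _ : Fin N => E) i).comp
        (ContinuousLinearMap.fst ℝ _ _)).prod
        ((ContinuousLinearMap.proj (R := ℝ) (φ := fun _ : Fin N => StrongDual ℝ V) i).comp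
        (ContinuousLinearMap.snd ℝ (Fin N → E) _))).hasFDerivAt
  have h2 : ∀ i, HasFDerivAt (fun p : (Fin N → E) × (Fin N → StrongDual ℝ V) =>
      p.2 i (coupling 𝒩 J p.2 i)) _ (ξ, a) := fun i => by
    simp only [← couplingCLM_apply]
    exact ((ContinuousLinearMap.proj (R := ℝ) (φ := fun _ : Fin N => StrongDual ℝ V) i).comp
        (ContinuousLinearMap.snd ℝ (Fin N → E) _)).hasFDerivAt.clm_apply
      ((couplingCLM 𝒩 J i).comp (ContinuousLinearMap.snd ℝ (Fin N → E) _)).hasFDerivAt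
  refine ((HasFDerivAt.fun_sum fun i (_ : i ∈ Finset.univ) => h1 i).add
    ((HasFDerivAt.fun_sum fun i (_ : i ∈ Finset.univ) => h2 i).const_mul (1 / 2))).congr_fderiv ?_
  refine ContinuousLinearMap.ext fun ⟨u, b⟩ => ?_
  rw [reducedDeriv_apply]
  -- The product rule yields `(1/2) (⟨a, C b⟩ + ⟨b, C a⟩)`; by symmetry the two terms agree.
  have h3 := sum_apply_coupling_comm 𝒩 J hJ a b
  have h4 : ∀ i, fderiv ℝ (fun p : E × StrongDual ℝ V => nodeReduced L i p.1 p.2) (ξ i, a i)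
      (u i, b i) = fderiv ℝ (fun ζ => nodeReduced L i ζ (a i)) (ξ i) (u i) +
        b i (varDeriv (fun b => nodeReduced L i (ξ i) b) (a i)) := fun i => by
    rw [fderiv_partial_add ((hl i).differentiable (by simp) _), apply_varDeriv]
  simp [h4, couplingCLM_apply, Finset.sum_add_distrib, h3]
  ring

variable [FiniteDimensional ℝ E] [LieGroup 𝓘(ℝ, E) ∞ G]

variable (L) in
/-- The right-hand side of the `i`-th network Euler-Poincaré equation. -/
def epForce (ξ : Fin N → E) (a : Fin N → StrongDual ℝ V) (i : Fin N) : StrongDual ℝ E :=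
  adStar G (ξ i) (fderiv ℝ (fun ζ => nodeReduced L i ζ (a i)) (ξ i)) +
    diamond ρ (varDeriv (fun b => nodeReduced L i (ξ i) b) (a i)) (a i) +
    diamond ρ (coupling 𝒩 J a i) (a i)

theorem epForce_apply (ξ : Fin N → E) (a : Fin N → StrongDual ℝ V) (i : Fin N) (η : E) :
    epForce 𝒩 J ρ L ξ a i η =
      fderiv ℝ (fun ζ => nodeReduced L i ζ (a i)) (ξ i) (lieBr G (ξ i) η) -
      infAct ρ (a i) η (varDeriv (fun b => nodeReduced L i (ξ i) b) (a i) +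
        coupling 𝒩 J a i) := by
  simp only [epForce, add_apply, adStar_apply, diamond_apply, map_add]
  ring

/-- Transposing `[ξ, ·]` and `η ↦ -η a` onto the dual side produces exactly the coadjoint and
diamond terms, leaving `η'` paired with the momentum. -/
theorem reducedDeriv_variation (ξ : Fin N → E) (a : Fin N → StrongDual ℝ V) (η' η : Fin N → E) :
    reducedDeriv 𝒩 J L ξ a
      (fun i => η' i + lieBr G (ξ i) (η i), fun i => -(infAct ρ (a i) (η i))) =
    ∑ i, (fderiv ℝ (fun ζ => nodeReduced L i ζ (a i)) (ξ i) (η' i) +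
      epForce 𝒩 J ρ L ξ a i (η i)) := by
  rw [reducedDeriv_apply]
  refine Finset.sum_congr rfl fun i _ => ?_
  rw [epForce_apply, map_add, neg_apply]
  ring

end Derivative

/-! ### Differentiation under the integral, integration by parts, the fundamental lemma -/

section CalculusOfVariations

open MeasureTheory Set

theorem hasDerivAt_integral_of_contDiffOn {f : ℝ × ℝ → ℝ} {f' : ℝ → ℝ} {δ t₁ t₂ : ℝ} (hδ : 0 < δ)
    (ht : t₁ < t₂) (hf : ContDiffOn ℝ ∞ f (Ioo (-δ) δ ×ˢ Icc t₁ t₂))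
    (hf' : ∀ t ∈ Icc t₁ t₂, HasDerivAt (fun ε => f (ε, t)) (f' t) 0) :
    HasDerivAt (fun ε => ∫ t in t₁..t₂, f (ε, t)) (∫ t in t₁..t₂, f' t) 0 := by
  set S := Ioo (-δ) δ ×ˢ Icc t₁ t₂ with hS
  have hSu : UniqueDiffOn ℝ S := (isOpen_Ioo.uniqueDiffOn).prod (uniqueDiffOn_Icc ht)
  set F' : ℝ → ℝ → ℝ := fun ε t => fderivWithin ℝ f S (ε, t) (1, 0) with hF'
  have hcont : ContinuousOn (fun p : ℝ × ℝ => F' p.1 p.2) S :=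
    (hf.continuousOn_fderivWithin hSu (by simp)).clm_apply continuousOn_const
  have hder : ∀ ε ∈ Ioo (-δ) δ, ∀ t ∈ Icc t₁ t₂, HasDerivAt (fun ε => f (ε, t)) (F' ε t) ε := by
    intro ε hε t htm
    have h := hasDerivWithinAt_slice_left (p := (ε, t)) (I := Ioo (-δ) δ) (J := Icc t₁ t₂)
      ⟨hε, htm⟩ ((hf.differentiableOn (by simp) (ε, t) ⟨hε, htm⟩).hasFDerivWithinAt)
    exact h.hasDerivAt (isOpen_Ioo.mem_nhds hε)
  -- Halving the width gives a compact rectangle, on which the continuous derivative has a constant,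
  -- hence integrable, bound.
  have hsub : Icc (-(δ / 2)) (δ / 2) ×ˢ Icc t₁ t₂ ⊆ S := by
    rintro ⟨ε, t⟩ ⟨h1, h2⟩
    exact ⟨⟨by linarith [h1.1], by linarith [h1.2]⟩, h2⟩
  obtain ⟨C, hC⟩ := (isCompact_Icc.prod isCompact_Icc).exists_bound_of_continuousOn
    (hcont.mono hsub)
  have h0 : (0 : ℝ) ∈ Ioo (-δ) δ := ⟨by linarith, hδ⟩
  have hslice : ∀ (g : ℝ × ℝ → ℝ), ContinuousOn g S → ∀ ε ∈ Ioo (-δ) δ,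
      IntervalIntegrable (fun t => g (ε, t)) volume t₁ t₂ := by
    intro g hg ε hε
    refine ContinuousOn.intervalIntegrable ?_
    rw [uIcc_of_le ht.le]
    exact hg.comp (by fun_prop) fun t ht => ⟨hε, ht⟩
  have hioc : ∀ t ∈ uIoc t₁ t₂, t ∈ Icc t₁ t₂ := by
    rw [uIoc_of_le ht.le]; exact fun t h => Ioc_subset_Icc_self h
  have hmain := (intervalIntegral.hasDerivAt_integral_of_dominated_loc_of_deriv_le
    (μ := volume) (F := fun ε t => f (ε, t)) (F' := F') (bound := fun _ => C)
    (s := Icc (-(δ / 2)) (δ / 2)) (x₀ := (0 : ℝ)) (a := t₁) (b := t₂)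
    (Icc_mem_nhds (by linarith) (by linarith))
    (by
      filter_upwards [isOpen_Ioo.mem_nhds h0] with ε hε
      exact (hslice f hf.continuousOn ε hε).aestronglyMeasurable_restrict_uIoc)
    (hslice f hf.continuousOn 0 h0)
    ((hslice _ hcont 0 h0).aestronglyMeasurable_restrict_uIoc)
    (Filter.Eventually.of_forall fun t htm ε hε => hC (ε, t) ⟨hε, hioc t htm⟩)
    intervalIntegrable_const
    (Filter.Eventually.of_forall fun t htm ε hε =>
      hder ε (hsub ⟨hε, hioc t htm⟩ : (ε, t) ∈ S).1 t (hioc t htm))).2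
  refine hmain.congr_deriv (intervalIntegral.integral_congr fun t htm => ?_)
  rw [uIcc_of_le ht.le] at htm
  exact (hder 0 h0 t htm).unique (hf' t htm)

theorem integral_eq_sub_of_hasDerivWithinAt_Icc {w w' : ℝ → ℝ} {t₁ t₂ : ℝ} (ht : t₁ ≤ t₂)
    (hw : ∀ t ∈ Icc t₁ t₂, HasDerivWithinAt w (w' t) (Icc t₁ t₂) t)
    (hc : ContinuousOn w' (Icc t₁ t₂)) : ∫ t in t₁..t₂, w' t = w t₂ - w t₁ := by
  refine intervalIntegral.integral_eq_sub_of_hasDerivAt_of_le ht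
    (fun t h => (hw t h).continuousWithinAt)
    (fun t h => (hw t (Ioo_subset_Icc_self h)).hasDerivAt (Icc_mem_nhds h.1 h.2)) ?_
  exact ContinuousOn.intervalIntegrable (by rwa [uIcc_of_le ht])

/-- Compactly supported test functions give vanishing almost everywhere in the open interval.
Continuity improves this to every point, and then to the endpoints by closure. -/
theorem eqOn_zero_of_integral_mul_eq_zero {c : ℝ → ℝ} {t₁ t₂ : ℝ} (ht : t₁ < t₂)
    (hc : ContinuousOn c (Icc t₁ t₂))
    (h : ∀ ψ : ℝ → ℝ, ContDiff ℝ ∞ ψ → tsupport ψ ⊆ Ioo t₁ t₂ → ∫ t in t₁..t₂, ψ t * c t = 0) :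
    ∀ t ∈ Icc t₁ t₂, c t = 0 := by
  have hae : ∀ᵐ t ∂volume, t ∈ Ioo t₁ t₂ → c t = 0 := by
    refine isOpen_Ioo.ae_eq_zero_of_integral_contDiff_smul_eq_zero
      ((hc.mono Ioo_subset_Icc_self).locallyIntegrableOn measurableSet_Ioo)
      fun ψ hψ _ hs => ?_
    rw [← h ψ hψ hs, intervalIntegral.integral_of_le ht.le, integral_Ioc_eq_integral_Ioo]
    refine (setIntegral_eq_integral_of_forall_compl_eq_zero fun t htm => ?_).symm
    simp [image_eq_zero_of_notMem_tsupport fun h' => htm (hs h')]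
  have hae' : c =ᵐ[volume.restrict (Ioo t₁ t₂)] fun _ => 0 :=
    (ae_restrict_iff' measurableSet_Ioo).2 hae
  have hE : EqOn c (fun _ => 0) (Ioo t₁ t₂) :=
    Measure.eqOn_open_of_ae_eq hae' isOpen_Ioo (hc.mono Ioo_subset_Icc_self) continuousOn_const
  refine hE.of_subset_closure hc continuousOn_const Ioo_subset_Icc_self ?_
  rw [closure_Ioo ht.ne]

variable {E : Type*} [NormedAddCommGroup E] [NormedSpace ℝ E] {N : ℕ}
  {μ ν : ℝ → Fin N → StrongDual ℝ E} {t₁ t₂ : ℝ}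

theorem hasDerivWithinAt_sum_pairing {μ' : Fin N → StrongDual ℝ E} {η : ℝ → Fin N → E} {t : ℝ}
    (hμ : ∀ i, HasDerivWithinAt (fun s => μ s i) (μ' i) (Icc t₁ t₂) t)
    (hη : ∀ i, DifferentiableWithinAt ℝ (fun s => η s i) (Icc t₁ t₂) t) :
    HasDerivWithinAt (fun s => ∑ i, μ s i (η s i))
      (∑ i, (μ t i (derivWithin (fun s => η s i) (Icc t₁ t₂) t) + μ' i (η t i)))
      (Icc t₁ t₂) t := by
  refine HasDerivWithinAt.fun_sum fun i _ => ?_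
  have h := (hμ i).clm_apply (hη i).hasDerivWithinAt
  rwa [add_comm] at h

/-- Integration by parts in the first variation. -/
theorem integral_first_variation_eq_zero (ht : t₁ < t₂)
    (hμ : ∀ t ∈ Icc t₁ t₂, ∀ i, HasDerivWithinAt (fun s => μ s i) (ν t i) (Icc t₁ t₂) t)
    (hν : ∀ i, ContinuousOn (fun t => ν t i) (Icc t₁ t₂))
    {η : ℝ → Fin N → E} (hη : ContDiffOn ℝ ∞ η (Icc t₁ t₂)) (h₁ : η t₁ = 0) (h₂ : η t₂ = 0) :
    ∫ t in t₁..t₂, ∑ i, (μ t i (derivWithin (fun s => η s i) (Icc t₁ t₂) t) + ν t i (η t i)) =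
      0 := by
  have hηi : ∀ i, ContDiffOn ℝ ∞ (fun s => η s i) (Icc t₁ t₂) := fun i => contDiffOn_pi.1 hη i
  have h := integral_eq_sub_of_hasDerivWithinAt_Icc ht.le
    (fun t htm => hasDerivWithinAt_sum_pairing (hμ t htm)
      fun i => (hηi i).differentiableOn (by simp) t htm) ?_
  · rw [h, h₁, h₂]; simp
  · refine continuousOn_finsetSum _ fun i _ => ContinuousOn.add ?_ ?_
    · exact ContinuousOn.clm_apply (fun t htm => (hμ t htm i).continuousWithinAt)
        ((hηi i).continuousOn_derivWithin (uniqueDiffOn_Icc ht) (by simp))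
    · exact (hν i).clm_apply (hηi i).continuousOn

/-- The fundamental lemma of the calculus of variations, for the first variation. -/
theorem hasDerivWithinAt_of_integral_first_variation (ht : t₁ < t₂)
    (hμ : ∀ i, ContDiffOn ℝ ∞ (fun t => μ t i) (Icc t₁ t₂))
    (hν : ∀ i, ContinuousOn (fun t => ν t i) (Icc t₁ t₂))
    (h : ∀ η : ℝ → Fin N → E, ContDiff ℝ ∞ η → η t₁ = 0 → η t₂ = 0 →
      ∫ t in t₁..t₂, ∑ i, (μ t i (derivWithin (fun s => η s i) (Icc t₁ t₂) t) + ν t i (η t i)) =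
        0) :
    ∀ t ∈ Icc t₁ t₂, ∀ i, HasDerivWithinAt (fun s => μ s i) (ν t i) (Icc t₁ t₂) t := by
  have hu := uniqueDiffOn_Icc ht
  set μ' : ℝ → Fin N → StrongDual ℝ E := fun t i => derivWithin (fun s => μ s i) (Icc t₁ t₂) t
  have hμ' : ∀ t ∈ Icc t₁ t₂, ∀ i, HasDerivWithinAt (fun s => μ s i) (μ' t i) (Icc t₁ t₂) t :=
    fun t htm i => ((hμ i).differentiableOn (by simp) t htm).hasDerivWithinAt
  have hμ'c : ∀ i, ContinuousOn (fun t => μ' t i) (Icc t₁ t₂) := fun i =>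
    (hμ i).continuousOn_derivWithin hu (by simp)
  suffices hs : ∀ i, ∀ w : E, ∀ t ∈ Icc t₁ t₂, (ν t i - μ' t i) w = 0 by
    intro t htm i
    have : ν t i = μ' t i := by
      ext w
      have := hs i w t htm
      rwa [sub_apply, sub_eq_zero] at this
    rw [this]
    exact hμ' t htm i
  intro i w
  refine eqOn_zero_of_integral_mul_eq_zero ht
    (((hν i).sub (hμ'c i)).clm_apply continuousOn_const) fun ψ hψ hsupp => ?_
  -- A scalar test function in the fixed direction `w` at the single node `i` isolates one component
  -- of `ν - μ'`.
  set η : ℝ → Fin N → E := fun t => Pi.single i (ψ t • w) with hηdef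
  have hη : ContDiff ℝ ∞ η := by
    refine contDiff_pi.2 fun j => ?_
    rcases eq_or_ne j i with rfl | hj
    · simp only [hηdef, Pi.single_eq_same]
      exact hψ.smul contDiff_const
    · simpa [hηdef, hj] using contDiff_const
  have hz : ∀ t, t ∉ Ioo t₁ t₂ → η t = 0 := fun t htm => by
    simp [hηdef, image_eq_zero_of_notMem_tsupport fun h' => htm (hsupp h')]
  have h₁ : η t₁ = 0 := hz _ (by simp)
  have h₂ : η t₂ = 0 := hz _ (by simp)
  have e1 := h η hη h₁ h₂
  -- Integration by parts gives the same identity with the true derivative `μ'` in place of `ν`.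
  -- Subtracting removes the terms with the derivative of `η`.
  have e2 := integral_first_variation_eq_zero ht hμ' hμ'c hη.contDiffOn h₁ h₂
  have hηi : ∀ j, ContDiffOn ℝ ∞ (fun s => η s j) (Icc t₁ t₂) :=
    fun j => contDiffOn_pi.1 hη.contDiffOn j
  have hint : ∀ κ : ℝ → Fin N → StrongDual ℝ E, (∀ j, ContinuousOn (fun t => κ t j) (Icc t₁ t₂)) →
      IntervalIntegrable (fun t => ∑ j, (μ t j (derivWithin (fun s => η s j) (Icc t₁ t₂) t) +
        κ t j (η t j))) volume t₁ t₂ := fun κ hκ => by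
    refine ContinuousOn.intervalIntegrable ?_
    rw [uIcc_of_le ht.le]
    refine continuousOn_finsetSum _ fun j _ => ContinuousOn.add ?_ ?_
    · exact (hμ j).continuousOn.clm_apply ((hηi j).continuousOn_derivWithin hu (by simp))
    · exact (hκ j).clm_apply (hηi j).continuousOn
  have e3 := intervalIntegral.integral_sub (hint ν hν) (hint μ' hμ'c)
  rw [e1, e2, sub_zero] at e3
  rw [← e3]
  refine intervalIntegral.integral_congr fun t _ => ?_
  simp only [← Finset.sum_sub_distrib, add_sub_add_left_eq_sub]
  rw [Finset.sum_eq_single i]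
  · simp [hηdef, mul_sub]
  · intro j _ hj
    simp [hηdef, hj]
  · simp

end CalculusOfVariations

/-! ### Curves in the group: left invariance, advection, prescribed variations -/

section CurvesInGroup

open Set

variable {E : Type*} [NormedAddCommGroup E] [NormedSpace ℝ E]
  {G : Type*} [TopologicalSpace G] [ChartedSpace E G] [Group G]
  {V : Type*} [NormedAddCommGroup V] [NormedSpace ℝ V] {N : ℕ}

theorem bodyVelocity_congr {c d : ℝ → G} {I : Set ℝ} (h : EqOn c d I) {t : ℝ} (ht : t ∈ I) :
    (bodyVelocity I c t : E) = bodyVelocity I d t := by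
  have h1 : ((tangentLift (E := E) I c t).2 : E) = (tangentLift (E := E) I d t).2 :=
    congrArg (fun T : ℝ →L[ℝ] E => T 1)
      (mfderivWithin_congr (I := 𝓘(ℝ, ℝ)) (I' := 𝓘(ℝ, E)) h (h ht))
  change maurerCartan E (c t) _ = maurerCartan E (d t) _
  rw [h ht]
  exact congrArg (maurerCartan E (d t)) h1

theorem bodyVelocity_eq_zero {c : ℝ → G} {I : Set ℝ} {t : ℝ} (hI : I ∈ 𝓝 t)
    (h : mfderiv 𝓘(ℝ, ℝ) 𝓘(ℝ, E) c t = 0) : (bodyVelocity I c t : E) = 0 := by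
  have h1 : ((tangentLift (E := E) I c t).2 : E) = 0 :=
    congrArg (fun T : ℝ →L[ℝ] E => T 1)
      ((mfderivWithin_of_mem_nhds (I := 𝓘(ℝ, ℝ)) (I' := 𝓘(ℝ, E)) hI).trans h)
  exact (congrArg (maurerCartan E (c t)) h1).trans (map_zero _)

variable [LieGroup 𝓘(ℝ, E) ∞ G]

/-- In this form left invariance is visible: `(c t)⁻¹ * c s` is unchanged when `c` is replaced by `k
* c`. -/
theorem bodyVelocity_eq_mfderivWithin {c : ℝ → G} {I : Set ℝ} {t : ℝ}
    (hI : UniqueDiffWithinAt ℝ I t) (hc : MDifferentiableWithinAt 𝓘(ℝ, ℝ) 𝓘(ℝ, E) c I t) :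
    (bodyVelocity I c t : E) =
      (mfderivWithin 𝓘(ℝ, ℝ) 𝓘(ℝ, E) (fun s => (c t)⁻¹ * c s) I t : ℝ →L[ℝ] E) 1 := by
  have h := mfderiv_comp_mfderivWithin t
    ((contMDiffAt_leftMul (E := E) (c t)⁻¹ (c t)).mdifferentiableAt (by simp)) hc
    hI.uniqueMDiffWithinAt
  exact congrArg (fun T : ℝ →L[ℝ] E => T 1) h.symm

theorem bodyVelocity_leftMul {c : ℝ → G} {I : Set ℝ} {t : ℝ} (k : G)
    (hI : UniqueDiffWithinAt ℝ I t) (hc : MDifferentiableWithinAt 𝓘(ℝ, ℝ) 𝓘(ℝ, E) c I t) :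
    (bodyVelocity I (fun s => k * c s) t : E) = bodyVelocity I c t := by
  have hk : MDifferentiableWithinAt 𝓘(ℝ, ℝ) 𝓘(ℝ, E) (fun s => k * c s) I t :=
    ((contMDiffAt_leftMul (E := E) k (c t)).mdifferentiableAt
      (by simp)).comp_mdifferentiableWithinAt t hc
  rw [bodyVelocity_eq_mfderivWithin hI hk, bodyVelocity_eq_mfderivWithin hI hc]
  have h : (fun s => (k * c t)⁻¹ * (k * c s)) = fun s => (c t)⁻¹ * c s := by
    funext s; group
  have h' : ∀ d : ℝ → G, d = (fun s => (c t)⁻¹ * c s) →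
      (mfderivWithin 𝓘(ℝ, ℝ) 𝓘(ℝ, E) d I t : ℝ →L[ℝ] E) 1 =
      (mfderivWithin 𝓘(ℝ, ℝ) 𝓘(ℝ, E) (fun s => (c t)⁻¹ * c s) I t : ℝ →L[ℝ] E) 1 := by
    rintro d rfl; rfl
  exact h' _ h

/-- The curve `ε ↦ φ⁻¹(φ(1) + ε v)`, where `φ` is the chart at the identity, has velocity `v` at
`ε = 0`. -/
theorem bodyVelocity_chart_line {I : Set ℝ} (hI : UniqueDiffWithinAt ℝ I 0) (v : E) :
    bodyVelocity I (fun ε : ℝ => (chartAt E (1 : G)).symm (chartAt E (1 : G) 1 + ε • v)) 0 =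
      v := by
  set φ := chartAt E (1 : G) with hφ
  have he : φ ∈ IsManifold.maximalAtlas 𝓘(ℝ, E) ∞ G := IsManifold.chart_mem_maximalAtlas 1
  have h1 : φ 1 ∈ φ.target := mem_chart_target E 1
  have hs1 : φ.symm (φ 1) = 1 := φ.left_inv (mem_chart_source E 1)
  have hline : HasDerivAt (fun ε : ℝ => φ 1 + ε • v) v 0 := by
    simpa using ((hasDerivAt_id (0 : ℝ)).smul_const v).const_add (φ 1)
  have hev : ∀ᶠ ε : ℝ in 𝓝 0, φ 1 + ε • v ∈ φ.target := by
    refine hline.continuousAt.eventually_mem (φ.open_target.mem_nhds ?_)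
    simpa using h1
  have hd : HasDerivWithinAt (fun ε : ℝ => φ (φ.symm (φ 1 + ε • v))) v I 0 := by
    refine (hline.congr_of_eventuallyEq ?_).hasDerivWithinAt
    filter_upwards [hev] with ε hε using φ.right_inv hε
  have hcont : ContinuousWithinAt (fun ε : ℝ => φ.symm (φ 1 + ε • v)) I 0 := by
    refine ContinuousAt.continuousWithinAt (ContinuousAt.comp (g := φ.symm) ?_ hline.continuousAt)
    simpa using φ.continuousAt_symm h1
  rw [bodyVelocity_eq_chartMC he hI hcont (by
    simp only [zero_smul, add_zero, hs1]; exact mem_chart_source E (1 : G)) hd]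
  have h2 : chartMC φ (φ 1) = ContinuousLinearMap.id ℝ E := by
    have hev' : (fun y => φ ((φ.symm (φ 1))⁻¹ * φ.symm y)) =ᶠ[𝓝 (φ 1)] id := by
      filter_upwards [φ.open_target.mem_nhds h1] with y hy
      simp [hs1, φ.right_inv hy]
    rw [chartMC, ← hφ, hev'.fderiv_eq, fderiv_id]
  simp [hs1, h2]

/-- Used in two directions: along time it is the advection equation `a' = -ξ a`, and along the
family parameter it is the constraint `δa = -η a`. -/
theorem hasDerivWithinAt_dualAct_inv {ρ : G →* (V →L[ℝ] V)}
    (hρ : ContMDiff 𝓘(ℝ, E) 𝓘(ℝ, V →L[ℝ] V) ∞ ρ) {c : ℝ → G} {I : Set ℝ} {t : ℝ}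
    (hI : UniqueDiffWithinAt ℝ I t) (hc : ContMDiffWithinAt 𝓘(ℝ, ℝ) 𝓘(ℝ, E) ∞ c I t)
    (A : StrongDual ℝ V) :
    HasDerivWithinAt (fun s => dualAct ρ (c s)⁻¹ A)
      (-(infAct ρ (dualAct ρ (c t)⁻¹ A) (bodyVelocity I c t : E))) I t := by
  have he := IsManifold.chart_mem_maximalAtlas (I := 𝓘(ℝ, E)) (n := ∞) (c t)
  have hs := mem_chart_source E (c t)
  set e := chartAt E (c t)
  have hx : ContDiffWithinAt ℝ ∞ (fun s => e (c s)) I t :=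
    (ContMDiffAt.comp_contMDiffWithinAt t (contMDiffAt_chart he hs) hc).contDiffWithinAt
  have hv := (hx.differentiableWithinAt (by simp)).hasDerivWithinAt
  rw [bodyVelocity_eq_chartMC he hI hc.continuousWithinAt hs hv]
  have h := (hasFDerivAt_rep_chart_symm hρ he (e.map_source hs) A).comp_hasDerivWithinAt t hv
  rw [e.left_inv hs] at h
  refine h.congr_of_eventuallyEq ?_ (by simp [e.left_inv hs])
  filter_upwards [hc.continuousWithinAt.eventually_mem (e.open_source.mem_nhds hs)] with s hs'
  simp [e.left_inv hs']

/-- Variations of a curve in `G^N` in the direction of given curves in the Lie algebra. -/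
theorem exists_family_of_variation {t₁ t₂ : ℝ} {g : ℝ → Fin N → G}
    (hg : ∀ i, ContMDiffOn 𝓘(ℝ, ℝ) 𝓘(ℝ, E) ∞ (fun t => g t i) (Icc t₁ t₂))
    {η : ℝ → Fin N → E} (hη : ContDiff ℝ ∞ η) :
    ∃ (δ : ℝ) (γ : ℝ → ℝ → Fin N → G), 0 < δ ∧
      (∀ i, ContMDiffOn 𝓘(ℝ, ℝ × ℝ) 𝓘(ℝ, E) ∞ (fun p : ℝ × ℝ => γ p.1 p.2 i)
        (Ioo (-δ) δ ×ˢ Icc t₁ t₂)) ∧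
      (∀ t, γ 0 t = g t) ∧
      (∀ t, η t = 0 → ∀ i, mfderiv 𝓘(ℝ, ℝ) 𝓘(ℝ, E) (fun ε => γ ε t i) 0 = 0) ∧
      ∀ t i, bodyVelocity (Ioo (-δ) δ) (fun ε => γ ε t i) 0 = η t i := by
  set φ := chartAt E (1 : G) with hφ
  have he : φ ∈ IsManifold.maximalAtlas 𝓘(ℝ, E) ∞ G := IsManifold.chart_mem_maximalAtlas 1
  have h1 : φ 1 ∈ φ.target := mem_chart_target E 1
  have hs1 : φ.symm (φ 1) = 1 := φ.left_inv (mem_chart_source E 1)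
  -- The family is `g(t) φ⁻¹(φ(1) + ε η(t))`, the chart at the identity playing the role of the
  -- exponential map. If `C` bounds `η` on the compact interval and `r` is the radius of a ball
  -- inside the chart target, then `|ε| < r / (|C| + 1)` keeps the line in the target; the `+ 1`
  -- makes the denominator positive.
  obtain ⟨r, hr, hball⟩ := Metric.isOpen_iff.1 φ.open_target _ h1
  obtain ⟨C, hC⟩ := isCompact_Icc.exists_bound_of_continuousOn
    (hη.continuous.continuousOn (s := Icc t₁ t₂))
  have hC1 : 0 < |C| + 1 := by positivity
  have hδ : 0 < r / (|C| + 1) := by positivity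
  have hmem : ∀ ε ∈ Ioo (-(r / (|C| + 1))) (r / (|C| + 1)), ∀ t ∈ Icc t₁ t₂, ∀ i,
      φ 1 + ε • η t i ∈ φ.target := by
    intro ε hε t htm i
    apply hball
    rw [mem_ball_iff_norm, add_sub_cancel_left, norm_smul, Real.norm_eq_abs]
    have hn : ‖η t i‖ ≤ |C| := (norm_le_pi_norm (η t) i).trans ((hC t htm).trans (le_abs_self C))
    calc |ε| * ‖η t i‖ ≤ |ε| * (|C| + 1) := by gcongr; linarith
      _ < r / (|C| + 1) * (|C| + 1) := by gcongr; exact abs_lt.2 hε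
      _ = r := by field_simp
  refine ⟨r / (|C| + 1), fun ε t i => g t i * φ.symm (φ 1 + ε • η t i), hδ, fun i => ?_,
    fun t => ?_, fun t htz i => ?_, fun t i => ?_⟩
  · have ha : ContMDiffOn 𝓘(ℝ, ℝ × ℝ) 𝓘(ℝ, E) ∞ (fun p : ℝ × ℝ => g p.2 i)
        (Ioo (-(r / (|C| + 1))) (r / (|C| + 1)) ×ˢ Icc t₁ t₂) :=
      (hg i).comp (contDiff_snd.contMDiff.contMDiffOn) fun p hp => hp.2
    have hηi : ContDiff ℝ ∞ fun t => η t i := contDiff_pi.1 hη i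
    have hb : ContDiff ℝ ∞ fun p : ℝ × ℝ => φ 1 + p.1 • η p.2 i := by fun_prop
    exact ha.mul ((contMDiffOn_symm_of_mem_maximalAtlas he).comp hb.contMDiff.contMDiffOn
      fun p hp => hmem p.1 hp.1 p.2 hp.2 i)
  · funext i; simp [hs1]
  · have hcst : (fun ε : ℝ => g t i * φ.symm (φ 1 + ε • η t i)) = fun _ => g t i := by
      funext ε; simp [htz, hs1]
    have hd : ∀ d : ℝ → G, d = (fun _ => g t i) → mfderiv 𝓘(ℝ, ℝ) 𝓘(ℝ, E) d 0 = 0 := by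
      rintro d rfl; exact mfderiv_const
    exact hd _ hcst
  · have hI : UniqueDiffWithinAt ℝ (Ioo (-(r / (|C| + 1))) (r / (|C| + 1))) 0 :=
      isOpen_Ioo.uniqueDiffOn 0 ⟨by linarith, hδ⟩
    rw [bodyVelocity_leftMul (g t i) hI, bodyVelocity_chart_line hI]
    have hb : ContDiff ℝ ∞ fun ε : ℝ => φ 1 + ε • η t i := by fun_prop
    have hs : ContMDiffAt 𝓘(ℝ, E) 𝓘(ℝ, E) ∞ φ.symm (φ 1 + (0 : ℝ) • η t i) := by
      simpa using contMDiffAt_chart_symm he h1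
    exact ((hs.comp 0 hb.contMDiff.contMDiffAt).mdifferentiableAt
      (by simp)).mdifferentiableWithinAt

end CurvesInGroup

/-! ### The first variation of the reduced action -/

section FirstVariation

open Set

variable {E : Type*} [NormedAddCommGroup E] [NormedSpace ℝ E] [FiniteDimensional ℝ E]
  {G : Type*} [TopologicalSpace G] [ChartedSpace E G] [Group G] [LieGroup 𝓘(ℝ, E) ∞ G]
  {V : Type*} [NormedAddCommGroup V] [NormedSpace ℝ V] {N : ℕ}

/-- A smooth family of curves induces a constrained variation of the reduced variables. -/
theorem family_variation {ρ : G →* (V →L[ℝ] V)}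
    (hρ : ContMDiff 𝓘(ℝ, E) 𝓘(ℝ, V →L[ℝ] V) ∞ ρ) (A : Fin N → StrongDual ℝ V)
    {δ t₁ t₂ : ℝ} (hδ : 0 < δ) (ht : t₁ < t₂) {γ : ℝ → ℝ → Fin N → G}
    (hγ : ∀ i, ContMDiffOn 𝓘(ℝ, ℝ × ℝ) 𝓘(ℝ, E) ∞ (fun p : ℝ × ℝ => γ p.1 p.2 i)
      (Ioo (-δ) δ ×ˢ Icc t₁ t₂))
    {Ξ : ℝ → ℝ → Fin N → E} {α : ℝ → ℝ → Fin N → StrongDual ℝ V} {η : ℝ → Fin N → E}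
    (hΞ : Ξ = fun ε t i => bodyVelocity (Icc t₁ t₂) (fun s => γ ε s i) t)
    (hα : α = fun ε t i => dualAct ρ (γ ε t i)⁻¹ (A i))
    (hη : η = fun t i => bodyVelocity (Ioo (-δ) δ) (fun ε => γ ε t i) 0) :
    ContDiffOn ℝ ∞ η (Icc t₁ t₂) ∧
    ContDiffOn ℝ ∞ (fun p : ℝ × ℝ => Ξ p.1 p.2) (Ioo (-δ) δ ×ˢ Icc t₁ t₂) ∧
    ContDiffOn ℝ ∞ (fun p : ℝ × ℝ => α p.1 p.2) (Ioo (-δ) δ ×ˢ Icc t₁ t₂) ∧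
    ∀ t ∈ Icc t₁ t₂, ∀ i,
      HasDerivAt (fun ε => Ξ ε t i)
        (derivWithin (fun s => η s i) (Icc t₁ t₂) t + lieBr G (Ξ 0 t i) (η t i)) 0 ∧
      HasDerivAt (fun ε => α ε t i) (-(infAct ρ (α 0 t i) (η t i))) 0 := by
  subst hΞ hα hη
  have hI : UniqueDiffOn ℝ (Ioo (-δ) δ) := isOpen_Ioo.uniqueDiffOn
  have hJ : UniqueDiffOn ℝ (Icc t₁ t₂) := uniqueDiffOn_Icc ht
  have h0 : (0 : ℝ) ∈ Ioo (-δ) δ := ⟨by linarith, hδ⟩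
  have h0n : Ioo (-δ) δ ∈ 𝓝 (0 : ℝ) := isOpen_Ioo.mem_nhds h0
  refine ⟨contDiffOn_pi.2 fun i => ?_, contDiffOn_pi.2 fun i => ?_, contDiffOn_pi.2 fun i => ?_,
    fun t htm i => ⟨?_, ?_⟩⟩
  · exact (contDiffOn_bodyVelocity_left hI hJ (hγ i)).comp (s := Icc t₁ t₂)
      (f := fun t => ((0 : ℝ), t)) (by fun_prop) fun t htm => ⟨h0, htm⟩
  · exact contDiffOn_bodyVelocity_right hI hJ (hγ i)
  · exact ((contMDiff_dualAct_inv hρ (A i)).comp_contMDiffOn (hγ i)).contDiffOn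
  · refine (hasDerivWithinAt_bodyVelocity hI hJ (hγ i) (p := (0, t)) ⟨h0, htm⟩ ?_).hasDerivAt h0n
    rw [interior_prod_eq, interior_Icc, isOpen_Ioo.interior_eq, closure_prod_eq,
      closure_Ioo ht.ne]
    exact ⟨subset_closure h0, htm⟩
  · refine (hasDerivWithinAt_dualAct_inv hρ (hI 0 h0) ?_ (A i)).hasDerivAt h0n
    exact (hγ i (0, t) ⟨h0, htm⟩).comp (t := Ioo (-δ) δ ×ˢ Icc t₁ t₂) (f := fun ε : ℝ => (ε, t)) 0
      (by
        have : ContDiff ℝ ∞ fun ε : ℝ => (ε, t) := by fun_prop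
        exact this.contMDiff.contMDiffAt.contMDiffWithinAt) fun ε hε => ⟨hε, htm⟩

variable [FiniteDimensional ℝ V] (𝒩 : SimpleGraph (Fin N)) [DecidableRel 𝒩.Adj]
  (ρ : G →* (V →L[ℝ] V)) {J : Fin N → Fin N → StrongDual ℝ V →L[ℝ] V}
  {L : Fin N → TangentBundle 𝓘(ℝ, E) G → StrongDual ℝ V → ℝ}

/-- The derivative of the action depends on the family only through `η`, so one formula serves both
the families coming from curves in the group and the arbitrary families of the constrained
principle. -/
theorem hasDerivAt_reduced_action
    (hJ : ∀ i j, 𝒩.Adj i j → ∀ a b : StrongDual ℝ V, a (J i j b) = b (J j i a))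
    (hl : ∀ i, ContDiff ℝ ∞ (fun p : E × StrongDual ℝ V => nodeReduced L i p.1 p.2))
    {δ t₁ t₂ : ℝ} (hδ : 0 < δ) (ht : t₁ < t₂) {ξ : ℝ → Fin N → E} {a : ℝ → Fin N → StrongDual ℝ V}
    {Ξ : ℝ → ℝ → Fin N → E} {α : ℝ → ℝ → Fin N → StrongDual ℝ V} {η : ℝ → Fin N → E}
    (hΞ : ContDiffOn ℝ ∞ (fun p : ℝ × ℝ => Ξ p.1 p.2) (Ioo (-δ) δ ×ˢ Icc t₁ t₂))
    (hα : ContDiffOn ℝ ∞ (fun p : ℝ × ℝ => α p.1 p.2) (Ioo (-δ) δ ×ˢ Icc t₁ t₂))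
    (h0 : ∀ t ∈ Icc t₁ t₂, Ξ 0 t = ξ t ∧ α 0 t = a t)
    (hvar : ∀ t ∈ Icc t₁ t₂, ∀ i,
      HasDerivAt (fun ε => Ξ ε t i)
        (derivWithin (fun s => η s i) (Icc t₁ t₂) t + lieBr G (ξ t i) (η t i)) 0 ∧
      HasDerivAt (fun ε => α ε t i) (-(infAct ρ (a t i) (η t i))) 0) :
    HasDerivAt (fun ε => ∫ t in t₁..t₂, reducedLagrangian 𝒩 ρ J L (Ξ ε t) (α ε t))
      (∫ t in t₁..t₂, ∑ i, (fderiv ℝ (fun ζ => nodeReduced L i ζ (a t i)) (ξ t i)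
        (derivWithin (fun s => η s i) (Icc t₁ t₂) t) + epForce 𝒩 J ρ L (ξ t) (a t) i (η t i)))
      0 := by
  refine hasDerivAt_integral_of_contDiffOn
    (f := fun p : ℝ × ℝ => reducedLagrangian 𝒩 ρ J L (Ξ p.1 p.2) (α p.1 p.2)) hδ ht
    ((contDiff_reducedLagrangian 𝒩 J ρ hl).comp_contDiffOn (hΞ.prodMk hα)) fun t htm => ?_
  have h1 : HasDerivAt (fun ε => (Ξ ε t, α ε t)) _ 0 :=
    (hasDerivAt_pi.2 fun i => (hvar t htm i).1).prodMk (hasDerivAt_pi.2 fun i => (hvar t htm i).2)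
  have h2 := hasFDerivAt_reducedLagrangian 𝒩 J ρ hJ hl (ξ t) (a t)
  rw [← (h0 t htm).1, ← (h0 t htm).2] at h2
  have h3 := h2.comp_hasDerivAt 0 h1
  rw [(h0 t htm).1, (h0 t htm).2, reducedDeriv_variation] at h3
  exact h3

end FirstVariation

/-! ### The Euler-Lagrange equations in local coordinates -/

section LocalCoordinates

open Set

variable {E : Type*} [NormedAddCommGroup E] [NormedSpace ℝ E] [FiniteDimensional ℝ E]
  {G : Type*} [TopologicalSpace G] [ChartedSpace E G] [Group G] [LieGroup 𝓘(ℝ, E) ∞ G]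
  {V : Type*} [NormedAddCommGroup V] [NormedSpace ℝ V] [FiniteDimensional ℝ V] {N : ℕ}
  (𝒩 : SimpleGraph (Fin N)) [DecidableRel 𝒩.Adj]
  (ρ : G →* (V →L[ℝ] V)) {J : Fin N → Fin N → StrongDual ℝ V →L[ℝ] V}
  {L : Fin N → TangentBundle 𝓘(ℝ, E) G → StrongDual ℝ V → ℝ} {A : Fin N → StrongDual ℝ V}
  {e : Fin N → OpenPartialHomeomorph G E}

omit [FiniteDimensional ℝ E] [FiniteDimensional ℝ V] in
theorem localLagrangian_eq_reduced
    (hinv : ∀ (i : Fin N) (h : G) (p : TangentBundle 𝓘(ℝ, E) G) (a : StrongDual ℝ V),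
      L i (tangentMap 𝓘(ℝ, E) 𝓘(ℝ, E) (fun k : G => h * k) p) (dualAct ρ h a) = L i p a)
    (he : ∀ i, e i ∈ IsManifold.maximalAtlas 𝓘(ℝ, E) ∞ G) {y : Fin N → E}
    (hy : ∀ i, y i ∈ (e i).target) (w : Fin N → E) :
    localLagrangian (fun p => fullLagrangian 𝒩 ρ J L p A) e y w = reducedLagrangian 𝒩 ρ J L
      (fun i => chartMC (e i) (y i) (w i)) (fun i => dualAct ρ ((e i).symm (y i))⁻¹ (A i)) := by
  have h := fullLagrangian_eq_reduced 𝒩 ρ J L hinv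
    (fun i => ⟨(e i).symm (y i), mfderiv 𝓘(ℝ, E) 𝓘(ℝ, E) (e i).symm (y i) (w i)⟩) A
  refine h.trans (congrArg (fun u : Fin N → E => reducedLagrangian 𝒩 ρ J L u
    (fun i => dualAct ρ ((e i).symm (y i))⁻¹ (A i))) ?_)
  funext i
  exact maurerCartan_modelDeriv_symm (he i) (hy i) (w i)

omit [FiniteDimensional ℝ E] in
-- At a fixed position the advected variables are constant and the body velocity is linear in `w`,
-- so the coordinate momentum is the body momentum composed with the Maurer-Cartan form.
theorem fderiv_localLagrangian_velocity
    (hJ : ∀ i j, 𝒩.Adj i j → ∀ a b : StrongDual ℝ V, a (J i j b) = b (J j i a))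
    (hl : ∀ i, ContDiff ℝ ∞ (fun p : E × StrongDual ℝ V => nodeReduced L i p.1 p.2))
    (hinv : ∀ (i : Fin N) (h : G) (p : TangentBundle 𝓘(ℝ, E) G) (a : StrongDual ℝ V),
      L i (tangentMap 𝓘(ℝ, E) 𝓘(ℝ, E) (fun k : G => h * k) p) (dualAct ρ h a) = L i p a)
    (he : ∀ i, e i ∈ IsManifold.maximalAtlas 𝓘(ℝ, E) ∞ G) {y : Fin N → E}
    (hy : ∀ i, y i ∈ (e i).target) (w : Fin N → E) {ξ : Fin N → E} {a : Fin N → StrongDual ℝ V}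
    (hξ : ∀ i, chartMC (e i) (y i) (w i) = ξ i)
    (ha : ∀ i, dualAct ρ ((e i).symm (y i))⁻¹ (A i) = a i) :
    fderiv ℝ (fun w => localLagrangian (fun p => fullLagrangian 𝒩 ρ J L p A) e y w) w =
      ∑ i, (fderiv ℝ (fun ζ => nodeReduced L i ζ (a i)) (ξ i)).comp
        ((chartMC (e i) (y i)).comp (ContinuousLinearMap.proj i)) := by
  obtain rfl := funext hξ
  obtain rfl := funext ha
  simp only [localLagrangian_eq_reduced 𝒩 ρ hinv he hy]
  have h1 : HasFDerivAt (fun w : Fin N → E => ((fun i => chartMC (e i) (y i) (w i) : Fin N → E),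
      (fun i => dualAct ρ ((e i).symm (y i))⁻¹ (A i) : Fin N → StrongDual ℝ V))) _ w :=
    (ContinuousLinearMap.pi fun i => (chartMC (e i) (y i)).comp
      (ContinuousLinearMap.proj (R := ℝ) (φ := fun _ : Fin N => E) i)).hasFDerivAt.prodMk
      (hasFDerivAt_const _ w)
  have h2 := (hasFDerivAt_reducedLagrangian 𝒩 J ρ hJ hl
    (fun i => chartMC (e i) (y i) (w i))
    (fun i => dualAct ρ ((e i).symm (y i))⁻¹ (A i))).comp w h1
  refine h2.fderiv.trans (ContinuousLinearMap.ext fun z => ?_)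
  have h3 := reducedDeriv_apply 𝒩 J (L := L) (fun i => chartMC (e i) (y i) (w i))
    (fun i => dualAct ρ ((e i).symm (y i))⁻¹ (A i)) (fun i => chartMC (e i) (y i) (z i)) 0
  refine Eq.trans ?_ (h3.trans ?_)
  · rfl
  · simp

/-- Moving the position changes both `ω(y) w` and the advected variables. The Maurer-Cartan equation
replaces `Dω(z) w` by `Dω(w) z + [ω w, ω z]`: the bracket joins the force, and `Dω(w) z` is the term
that also appears in the time derivative of the coordinate momentum. -/
theorem fderiv_localLagrangian_position (hρ : ContMDiff 𝓘(ℝ, E) 𝓘(ℝ, V →L[ℝ] V) ∞ ρ)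
    (hJ : ∀ i j, 𝒩.Adj i j → ∀ a b : StrongDual ℝ V, a (J i j b) = b (J j i a))
    (hl : ∀ i, ContDiff ℝ ∞ (fun p : E × StrongDual ℝ V => nodeReduced L i p.1 p.2))
    (hinv : ∀ (i : Fin N) (h : G) (p : TangentBundle 𝓘(ℝ, E) G) (a : StrongDual ℝ V),
      L i (tangentMap 𝓘(ℝ, E) 𝓘(ℝ, E) (fun k : G => h * k) p) (dualAct ρ h a) = L i p a)
    (he : ∀ i, e i ∈ IsManifold.maximalAtlas 𝓘(ℝ, E) ∞ G) {y : Fin N → E}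
    (hy : ∀ i, y i ∈ (e i).target) (w : Fin N → E) {ξ : Fin N → E} {a : Fin N → StrongDual ℝ V}
    (hξ : ∀ i, chartMC (e i) (y i) (w i) = ξ i)
    (ha : ∀ i, dualAct ρ ((e i).symm (y i))⁻¹ (A i) = a i) (z : Fin N → E) :
    fderiv ℝ (fun y => localLagrangian (fun p => fullLagrangian 𝒩 ρ J L p A) e y w) y z =
      ∑ i, (fderiv ℝ (fun ζ => nodeReduced L i ζ (a i)) (ξ i)
        (fderiv ℝ (chartMC (e i)) (y i) (w i) (z i)) +
        epForce 𝒩 J ρ L ξ a i (chartMC (e i) (y i) (z i))) := by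
  obtain rfl := funext hξ
  obtain rfl := funext ha
  have hev : ∀ᶠ y' in 𝓝 y, ∀ i, y' i ∈ (e i).target :=
    Filter.eventually_all.2 fun i =>
      (continuous_apply i).continuousAt.eventually_mem ((e i).open_target.mem_nhds (hy i))
  have h0 : (fun y' => localLagrangian (fun p => fullLagrangian 𝒩 ρ J L p A) e y' w) =ᶠ[𝓝 y]
      fun y' => reducedLagrangian 𝒩 ρ J L (fun i => chartMC (e i) (y' i) (w i))
        (fun i => dualAct ρ ((e i).symm (y' i))⁻¹ (A i)) := by
    filter_upwards [hev] with y' hy' using localLagrangian_eq_reduced 𝒩 ρ hinv he hy' w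
  have hω : ∀ i, HasFDerivAt (fun y' : Fin N → E => chartMC (e i) (y' i) (w i)) _ y := fun i =>
    (HasFDerivAt.comp (g := chartMC (e i)) (f := fun y' : Fin N → E => y' i) y
      ((contDiffAt_chartMC (he i) (hy i)).differentiableAt (by simp)).hasFDerivAt
      (hasFDerivAt_apply i y)).clm_apply (hasFDerivAt_const (w i) y)
  have hα : ∀ i, HasFDerivAt (fun y' : Fin N → E => dualAct ρ ((e i).symm (y' i))⁻¹ (A i)) _ y :=
    fun i => HasFDerivAt.comp (g := fun z => dualAct ρ ((e i).symm z)⁻¹ (A i))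
      (f := fun y' : Fin N → E => y' i) y
      (hasFDerivAt_rep_chart_symm hρ (he i) (hy i) (A i)) (hasFDerivAt_apply i y)
  have h1 : HasFDerivAt (fun y' : Fin N → E => ((fun i => chartMC (e i) (y' i) (w i) : Fin N → E),
      (fun i => dualAct ρ ((e i).symm (y' i))⁻¹ (A i) : Fin N → StrongDual ℝ V))) _ y :=
    (hasFDerivAt_pi.2 hω).prodMk (hasFDerivAt_pi.2 hα)
  have h2 := (hasFDerivAt_reducedLagrangian 𝒩 J ρ hJ hl
    (fun i => chartMC (e i) (y i) (w i))
    (fun i => dualAct ρ ((e i).symm (y i))⁻¹ (A i))).comp y h1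
  rw [h0.fderiv_eq]
  refine (congrArg (fun T : (Fin N → E) →L[ℝ] ℝ => T z) h2.fderiv).trans ?_
  have h3 := reducedDeriv_variation 𝒩 J ρ (L := L) (fun i => chartMC (e i) (y i) (w i))
    (fun i => dualAct ρ ((e i).symm (y i))⁻¹ (A i))
    (fun i => fderiv ℝ (chartMC (e i)) (y i) (w i) (z i))
    (fun i => chartMC (e i) (y i) (z i))
  rw [← h3]
  have h4 : ∀ i, fderiv ℝ (chartMC (e i)) (y i) (w i) (z i) +
      lieBr G (chartMC (e i) (y i) (w i)) (chartMC (e i) (y i) (z i)) =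
      fderiv ℝ (chartMC (e i)) (y i) (z i) (w i) := fun i => by
    rw [← neg_eq_iff_eq_neg.2 (maurerCartan_equation (he i) (hy i) (w i) (z i))]
    abel
  simp only [h4]
  change reducedDeriv 𝒩 J L _ _ (_, _) = _
  congr 2
  funext i
  simp

/-- In local coordinates, the Euler-Lagrange equations are the Euler-Poincaré equations. -/
theorem eulerLagrange_chart_iff (hρ : ContMDiff 𝓘(ℝ, E) 𝓘(ℝ, V →L[ℝ] V) ∞ ρ)
    (hJ : ∀ i j, 𝒩.Adj i j → ∀ a b : StrongDual ℝ V, a (J i j b) = b (J j i a))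
    (hl : ∀ i, ContDiff ℝ ∞ (fun p : E × StrongDual ℝ V => nodeReduced L i p.1 p.2))
    (hinv : ∀ (i : Fin N) (h : G) (p : TangentBundle 𝓘(ℝ, E) G) (a : StrongDual ℝ V),
      L i (tangentMap 𝓘(ℝ, E) 𝓘(ℝ, E) (fun k : G => h * k) p) (dualAct ρ h a) = L i p a)
    (he : ∀ i, e i ∈ IsManifold.maximalAtlas 𝓘(ℝ, E) ∞ G) {t₁ t₂ : ℝ} (ht : t₁ < t₂)
    {g : ℝ → Fin N → G}
    (hg : ∀ i, ContMDiffOn 𝓘(ℝ, ℝ) 𝓘(ℝ, E) ∞ (fun t => g t i) (Icc t₁ t₂))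
    {ξ : ℝ → Fin N → E} {a : ℝ → Fin N → StrongDual ℝ V}
    (hξ : ξ = fun t i => bodyVelocity (Icc t₁ t₂) (fun s => g s i) t)
    (ha : a = fun t i => dualAct ρ (g t i)⁻¹ (A i)) {t : ℝ} (htm : t ∈ Icc t₁ t₂)
    (hs : ∀ i, g t i ∈ (e i).source) {μ' : Fin N → StrongDual ℝ E}
    (hμ : ∀ i, HasDerivWithinAt (fun s => fderiv ℝ (fun ζ => nodeReduced L i ζ (a s i)) (ξ s i))
      (μ' i) (Icc t₁ t₂) t) {x v : ℝ → Fin N → E} (hx : x = fun s i => e i (g s i))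
    (hv : v = derivWithin x (Icc t₁ t₂)) :
    HasDerivWithinAt (fun s => fderiv ℝ (fun w =>
        localLagrangian (fun p => fullLagrangian 𝒩 ρ J L p A) e (x s) w) (v s))
      (fderiv ℝ (fun y => localLagrangian (fun p => fullLagrangian 𝒩 ρ J L p A) e y (v t)) (x t))
      (Icc t₁ t₂) t ↔ ∀ i, μ' i = epForce 𝒩 J ρ L (ξ t) (a t) i := by
  have hu := uniqueDiffOn_Icc ht
  have hxd : ∀ s ∈ Icc t₁ t₂, (∀ i, g s i ∈ (e i).source) → ∀ i,
      HasDerivWithinAt (fun s => x s i) (v s i) (Icc t₁ t₂) s := by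
    intro s hsm hss i
    have h1 : ∀ i, DifferentiableWithinAt ℝ (fun s => x s i) (Icc t₁ t₂) s := fun i => by
      subst hx
      exact ((contMDiffAt_chart (he i) (hss i)).comp_contMDiffWithinAt s
        (hg i s hsm)).contDiffWithinAt.differentiableWithinAt (by simp)
    have h2 := (differentiableWithinAt_pi.2 h1).hasDerivWithinAt
    rw [hv]
    exact hasDerivWithinAt_pi.1 h2 i
  have hy : ∀ s, (∀ i, g s i ∈ (e i).source) → ∀ i, x s i ∈ (e i).target := by
    intro s hss i; subst hx; exact (e i).map_source (hss i)
  have hξs : ∀ s ∈ Icc t₁ t₂, (∀ i, g s i ∈ (e i).source) → ∀ i,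
      chartMC (e i) (x s i) (v s i) = ξ s i := by
    intro s hsm hss i
    have h := hxd s hsm hss i
    subst hx hξ
    exact (bodyVelocity_eq_chartMC (he i) (hu s hsm) (hg i s hsm).continuousWithinAt (hss i)
      h).symm
  have has : ∀ s, (∀ i, g s i ∈ (e i).source) → ∀ i,
      dualAct ρ ((e i).symm (x s i))⁻¹ (A i) = a s i := by
    intro s hss i; subst hx ha; simp only [(e i).left_inv (hss i)]
  have hev : ∀ᶠ s in 𝓝[Icc t₁ t₂] t, ∀ i, g s i ∈ (e i).source :=
    Filter.eventually_all.2 fun i =>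
      (hg i t htm).continuousWithinAt.eventually_mem ((e i).open_source.mem_nhds (hs i))
  have hmom : (fun s => fderiv ℝ (fun w =>
      localLagrangian (fun p => fullLagrangian 𝒩 ρ J L p A) e (x s) w) (v s)) =ᶠ[𝓝[Icc t₁ t₂] t]
      fun s => ∑ i, (fderiv ℝ (fun ζ => nodeReduced L i ζ (a s i)) (ξ s i)).comp
        ((chartMC (e i) (x s i)).comp (ContinuousLinearMap.proj i)) := by
    filter_upwards [hev, self_mem_nhdsWithin] with s hss hsm
    exact fderiv_localLagrangian_velocity 𝒩 ρ hJ hl hinv he (hy s hss) (v s) (hξs s hsm hss)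
      (has s hss)
  have hω : ∀ i, HasDerivWithinAt (fun s => chartMC (e i) (x s i))
      (fderiv ℝ (chartMC (e i)) (x t i) (v t i)) (Icc t₁ t₂) t := fun i =>
    HasFDerivAt.comp_hasDerivWithinAt (l := chartMC (e i)) t
      ((contDiffAt_chartMC (he i) (hy t hs i)).differentiableAt (by simp)).hasFDerivAt
      (hxd t htm hs i)
  have hder : HasDerivWithinAt (fun s => ∑ i,
      (fderiv ℝ (fun ζ => nodeReduced L i ζ (a s i)) (ξ s i)).comp
        ((chartMC (e i) (x s i)).comp (ContinuousLinearMap.proj (R := ℝ) (φ := fun _ => E) i)))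
      _ (Icc t₁ t₂) t :=
    HasDerivWithinAt.fun_sum fun i _ => (hμ i).clm_comp ((hω i).clm_comp
      (hasDerivWithinAt_const t (Icc t₁ t₂) (ContinuousLinearMap.proj (R := ℝ) (φ := fun _ => E) i)))
  have hder' := hder.congr_of_eventuallyEq hmom (hmom.self_of_nhdsWithin htm)
  have hpos := fderiv_localLagrangian_position 𝒩 ρ hρ hJ hl hinv he (hy t hs) (v t)
    (hξs t htm hs) (has t hs)
  constructor
  · intro h i
    have h1 := (hu t htm).eq_deriv _ h hder'
    ext u
    -- Since the Maurer-Cartan form is onto, testing with coordinate vectors `z` supported at node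
    -- `i` reaches every element of the Lie algebra.
    obtain ⟨z, rfl⟩ := chartMC_surjective (he i) (hy t hs i) u
    have h2 := congrArg (fun T : (Fin N → E) →L[ℝ] ℝ => T (Pi.single i z)) h1
    simp only [hpos] at h2
    rw [Finset.sum_eq_single i (by intro j _ hj; simp [hj]) (by simp)] at h2
    simp only [sum_apply] at h2
    rw [Finset.sum_eq_single i (by intro j _ hj; simp [hj]) (by simp)] at h2
    simp at h2
    linarith
  · intro h
    refine hder'.congr_deriv (ContinuousLinearMap.ext fun z => ?_)
    rw [hpos]
    simp [h, add_comm]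

end LocalCoordinates

/-! ### The implications between the four conditions -/

section Equivalences

open Set

variable {E : Type*} [NormedAddCommGroup E] [NormedSpace ℝ E] [FiniteDimensional ℝ E]
  {G : Type*} [TopologicalSpace G] [ChartedSpace E G] [Group G] [LieGroup 𝓘(ℝ, E) ∞ G]
  {V : Type*} [NormedAddCommGroup V] [NormedSpace ℝ V]
  {N : ℕ} {ρ : G →* (V →L[ℝ] V)} {A : Fin N → StrongDual ℝ V}
  {t₁ t₂ : ℝ} {g : ℝ → Fin N → G} {ξ : ℝ → Fin N → E} {a : ℝ → Fin N → StrongDual ℝ V}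

omit [FiniteDimensional ℝ E] in
theorem contDiffOn_bodyVelocity (ht : t₁ < t₂)
    (hg : ∀ i, ContMDiffOn 𝓘(ℝ, ℝ) 𝓘(ℝ, E) ∞ (fun t => g t i) (Icc t₁ t₂))
    (hξ : ξ = fun t i => bodyVelocity (Icc t₁ t₂) (fun s => g s i) t) :
    ContDiffOn ℝ ∞ ξ (Icc t₁ t₂) := by
  subst hξ
  refine contDiffOn_pi.2 fun i => ?_
  -- A single curve is treated as a family that does not depend on its parameter.
  have hc : ContMDiffOn 𝓘(ℝ, ℝ × ℝ) 𝓘(ℝ, E) ∞ (fun p : ℝ × ℝ => g p.2 i)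
      (univ ×ˢ Icc t₁ t₂) :=
    (hg i).comp contDiff_snd.contMDiff.contMDiffOn fun p hp => hp.2
  exact (contDiffOn_bodyVelocity_right uniqueDiffOn_univ (uniqueDiffOn_Icc ht) hc).comp
    (s := Icc t₁ t₂) (f := fun t => ((0 : ℝ), t)) (by fun_prop) fun t htm => ⟨mem_univ _, htm⟩

variable [FiniteDimensional ℝ V] (𝒩 : SimpleGraph (Fin N)) [DecidableRel 𝒩.Adj]
  {J : Fin N → Fin N → StrongDual ℝ V →L[ℝ] V}
  {L : Fin N → TangentBundle 𝓘(ℝ, E) G → StrongDual ℝ V → ℝ}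

theorem continuousOn_epForce (hρ : ContMDiff 𝓘(ℝ, E) 𝓘(ℝ, V →L[ℝ] V) ∞ ρ)
    (hl : ∀ i, ContDiff ℝ ∞ (fun p : E × StrongDual ℝ V => nodeReduced L i p.1 p.2))
    {s : Set ℝ} (hξ : ContinuousOn ξ s) (ha : ContinuousOn a s) (i : Fin N) :
    ContinuousOn (fun t => epForce 𝒩 J ρ L (ξ t) (a t) i) s := by
  have hξi : ContinuousOn (fun t => ξ t i) s := continuousOn_pi.1 hξ i
  have hai : ContinuousOn (fun t => a t i) s := continuousOn_pi.1 ha i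
  refine continuousOn_clm_apply.2 fun η => ?_
  simp only [epForce_apply, map_add, apply_varDeriv, ← couplingCLM_apply]
  have hp : ContinuousOn (fun t => (ξ t i, a t i)) s := hξi.prodMk hai
  have h1 : ContinuousOn (fun t => lieBr G (ξ t i) η) s := by
    -- The bracket is packaged as a continuous linear map in its second argument; antisymmetry
    -- transfers continuity to the first.
    simp only [lieBr_swap (G := G) _ η]
    exact ((ad G η).continuous.comp_continuousOn hξi).neg
  have h2 : ContinuousOn (fun t => infAct ρ (a t i) η) s := by
    simp only [infAct_apply hρ]
    exact (hai.clm_comp continuousOn_const).neg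
  refine (((contDiff_momentum hl i).continuous.comp_continuousOn hp).clm_apply h1).sub
    ((((contDiff_fderiv_advected hl i).continuous.comp_continuousOn hp).clm_apply h2).add
      (h2.clm_apply ((couplingCLM 𝒩 J i).continuous.comp_continuousOn ha)))

omit [FiniteDimensional ℝ V] [FiniteDimensional ℝ E] [LieGroup 𝓘(ℝ, E) ∞ G] in
theorem contDiffOn_momentum_curve
    (hl : ∀ i, ContDiff ℝ ∞ (fun p : E × StrongDual ℝ V => nodeReduced L i p.1 p.2))
    {s : Set ℝ} (hξ : ContDiffOn ℝ ∞ ξ s) (ha : ContDiffOn ℝ ∞ a s) (i : Fin N) :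
    ContDiffOn ℝ ∞ (fun t => fderiv ℝ (fun ζ => nodeReduced L i ζ (a t i)) (ξ t i)) s :=
  (contDiff_momentum hl i).comp_contDiffOn ((contDiffOn_pi.1 hξ i).prodMk (contDiffOn_pi.1 ha i))

variable (hρ : ContMDiff 𝓘(ℝ, E) 𝓘(ℝ, V →L[ℝ] V) ∞ ρ)
  (hJ : ∀ i j, 𝒩.Adj i j → ∀ a b : StrongDual ℝ V, a (J i j b) = b (J j i a))
  (hl : ∀ i, ContDiff ℝ ∞ (fun p : E × StrongDual ℝ V => nodeReduced L i p.1 p.2))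
  (hinv : ∀ (i : Fin N) (h : G) (p : TangentBundle 𝓘(ℝ, E) G) (a : StrongDual ℝ V),
    L i (tangentMap 𝓘(ℝ, E) 𝓘(ℝ, E) (fun k : G => h * k) p) (dualAct ρ h a) = L i p a)
  (ht : t₁ < t₂)
  (hg : ∀ i, ContMDiffOn 𝓘(ℝ, ℝ) 𝓘(ℝ, E) ∞ (fun t => g t i) (Icc t₁ t₂))
  (hξ : ξ = fun t i => bodyVelocity (Icc t₁ t₂) (fun s => g s i) t)
  (ha : a = fun t i => dualAct ρ (g t i)⁻¹ (A i))

include hρ hg ha in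
omit [FiniteDimensional ℝ E] [FiniteDimensional ℝ V] [LieGroup 𝓘(ℝ, E) ∞ G] in
theorem contDiffOn_advected : ContDiffOn ℝ ∞ a (Icc t₁ t₂) := by
  subst ha
  exact contDiffOn_pi.2 fun i =>
    ((contMDiff_dualAct_inv hρ (A i)).comp_contMDiffOn (hg i)).contDiffOn

-- The advection half of the equations is automatic for `a = g⁻¹ A`, so only the momentum half
-- carries information.
include hρ ht hg hξ ha in
theorem eulerPoincare_iff :
    EulerPoincare 𝒩 ρ J (nodeReduced L) t₁ t₂ ξ a ↔ ∀ t ∈ Icc t₁ t₂, ∀ i,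
      HasDerivWithinAt (fun s => fderiv ℝ (fun ζ => nodeReduced L i ζ (a s i)) (ξ s i))
        (epForce 𝒩 J ρ L (ξ t) (a t) i) (Icc t₁ t₂) t := by
  refine ⟨fun h t htm i => (h t htm i).1, fun h t htm i => ⟨h t htm i, ?_⟩⟩
  subst hξ ha
  exact hasDerivWithinAt_dualAct_inv hρ (uniqueDiffOn_Icc ht t htm) (hg i t htm) (A i)

include hinv in
omit [FiniteDimensional ℝ E] [FiniteDimensional ℝ V] [LieGroup 𝓘(ℝ, E) ∞ G] in
theorem integral_lagrangian_eq_reduced (γ : ℝ → Fin N → G) :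
    ∫ t in t₁..t₂, fullLagrangian 𝒩 ρ J L
      (fun i => tangentLift (E := E) (Icc t₁ t₂) (fun s => γ s i) t) A =
    ∫ t in t₁..t₂, reducedLagrangian 𝒩 ρ J L
      (fun i => bodyVelocity (Icc t₁ t₂) (fun s => γ s i) t)
      (fun i => dualAct ρ (γ t i)⁻¹ (A i)) :=
  intervalIntegral.integral_congr fun _ _ => fullLagrangian_eq_reduced 𝒩 ρ J L hinv _ A

-- A family of curves in the group induces an admissible reduced family with `η = g⁻¹ δg`, and the
-- two actions agree for every parameter value.
include hρ hinv ht hξ ha in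
omit [FiniteDimensional ℝ V] in
theorem hamiltonPrinciple_of_constrainedPrinciple
    (h : ConstrainedPrinciple ρ (reducedLagrangian 𝒩 ρ J L) t₁ t₂ ξ a) :
    HamiltonPrinciple (fun p => fullLagrangian 𝒩 ρ J L p A) t₁ t₂ g := by
  intro δ γ hδ hγ h0 hv₁ hv₂
  have hn : Ioo (-δ) δ ∈ 𝓝 (0 : ℝ) := isOpen_Ioo.mem_nhds ⟨by linarith, hδ⟩
  obtain ⟨h1, h2, h3, h4⟩ := family_variation hρ A hδ ht hγ rfl rfl rfl
  have hξ0 : ∀ t ∈ Icc t₁ t₂,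
      (fun i => bodyVelocity (Icc t₁ t₂) (fun s => γ 0 s i) t : Fin N → E) = ξ t := by
    intro t htm; subst hξ; funext i
    exact bodyVelocity_congr (fun s hs => congrFun (h0 s hs) i) htm
  have ha0 : ∀ t ∈ Icc t₁ t₂, (fun i => dualAct ρ (γ 0 t i)⁻¹ (A i)) = a t := by
    intro t htm; subst ha; rw [h0 t htm]
  simp only [integral_lagrangian_eq_reduced 𝒩 hinv]
  refine h _ δ _ _ h1 ?_ ?_ hδ h2 h3 (fun t htm => ⟨hξ0 t htm, ha0 t htm⟩) fun t htm i => ?_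
  · funext i; exact bodyVelocity_eq_zero hn (hv₁ i)
  · funext i; exact bodyVelocity_eq_zero hn (hv₂ i)
  · rw [← hξ0 t htm, ← ha0 t htm]
    exact h4 t htm i

include hρ hJ hl ht hg hξ ha in
theorem constrainedPrinciple_of_eulerPoincare
    (h : EulerPoincare 𝒩 ρ J (nodeReduced L) t₁ t₂ ξ a) :
    ConstrainedPrinciple ρ (reducedLagrangian 𝒩 ρ J L) t₁ t₂ ξ a := by
  intro η δ Ξ α hη h₁ h₂ hδ hΞ hα h0 hvar
  refine (hasDerivAt_reduced_action 𝒩 ρ hJ hl hδ ht hΞ hα h0 hvar).congr_deriv ?_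
  exact integral_first_variation_eq_zero ht
    ((eulerPoincare_iff 𝒩 hρ ht hg hξ ha).1 h)
    (continuousOn_epForce 𝒩 hρ hl (contDiffOn_bodyVelocity ht hg hξ).continuousOn
      (contDiffOn_advected hρ hg ha).continuousOn) hη h₁ h₂

-- Each test variation `η` is realised by a family of curves in the group, so stationarity gives the
-- integral identity needed by the fundamental lemma.
include hρ hJ hl hinv ht hg hξ ha in
theorem eulerPoincare_of_hamiltonPrinciple
    (h : HamiltonPrinciple (fun p => fullLagrangian 𝒩 ρ J L p A) t₁ t₂ g) :
    EulerPoincare 𝒩 ρ J (nodeReduced L) t₁ t₂ ξ a := by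
  have hξs := contDiffOn_bodyVelocity ht hg hξ
  have has := contDiffOn_advected hρ hg ha
  rw [eulerPoincare_iff 𝒩 hρ ht hg hξ ha]
  refine hasDerivWithinAt_of_integral_first_variation ht
    (μ := fun t i => fderiv ℝ (fun ζ => nodeReduced L i ζ (a t i)) (ξ t i))
    (ν := fun t i => epForce 𝒩 J ρ L (ξ t) (a t) i)
    (contDiffOn_momentum_curve hl hξs has)
    (continuousOn_epForce 𝒩 hρ hl hξs.continuousOn has.continuousOn) fun η hη h₁ h₂ => ?_
  obtain ⟨δ, γ, hδ, hγ, h0, hz, hb⟩ := exists_family_of_variation hg hη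
  have e1 := h δ γ hδ hγ (fun t _ => h0 t) (hz t₁ h₁) (hz t₂ h₂)
  simp only [integral_lagrangian_eq_reduced 𝒩 hinv] at e1
  obtain ⟨-, h2, h3, h4⟩ := family_variation hρ A hδ ht hγ rfl rfl
    (funext fun t => funext fun i => (hb t i).symm)
  have hξ0 : ∀ t, (fun i => bodyVelocity (Icc t₁ t₂) (fun s => γ 0 s i) t : Fin N → E) = ξ t := by
    intro t; subst hξ; simp only [h0]
  have ha0 : ∀ t, (fun i => dualAct ρ (γ 0 t i)⁻¹ (A i)) = a t := by
    intro t; subst ha; simp only [h0]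
  refine (hasDerivAt_reduced_action 𝒩 ρ hJ hl hδ ht h2 h3 (fun t _ => ⟨hξ0 t, ha0 t⟩)
    fun t htm i => ?_).unique e1
  rw [← hξ0 t, ← ha0 t]
  exact h4 t htm i

-- At each time, the equation in a single system of charts around `g t` is already equivalent to
-- Euler-Poincaré at that time. The preferred charts suffice in one direction, and in the other
-- arbitrary charts are reached.
include hρ hJ hl hinv ht hg hξ ha in
theorem eulerLagrange_iff_eulerPoincare :
    EulerLagrange (fun p => fullLagrangian 𝒩 ρ J L p A) t₁ t₂ g ↔
      EulerPoincare 𝒩 ρ J (nodeReduced L) t₁ t₂ ξ a := by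
  have hμ : ∀ t ∈ Icc t₁ t₂, ∀ i,
      HasDerivWithinAt (fun s => fderiv ℝ (fun ζ => nodeReduced L i ζ (a s i)) (ξ s i)) _
        (Icc t₁ t₂) t := fun t htm i =>
    ((contDiffOn_momentum_curve hl (contDiffOn_bodyVelocity ht hg hξ)
      (contDiffOn_advected hρ hg ha) i).differentiableOn (by simp) t htm).hasDerivWithinAt
  rw [eulerPoincare_iff 𝒩 hρ ht hg hξ ha]
  constructor
  · intro h t htm i
    have h1 := (eulerLagrange_chart_iff 𝒩 ρ hρ hJ hl hinv
      (fun i => IsManifold.chart_mem_maximalAtlas (g t i)) ht hg hξ ha htm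
      (fun i => mem_chart_source E (g t i)) (hμ t htm) rfl rfl).1
      (h t htm (fun i => chartAt E (g t i)) fun i =>
        ⟨IsManifold.chart_mem_maximalAtlas (g t i), mem_chart_source E (g t i)⟩)
    exact (hμ t htm i).congr_deriv (h1 i)
  · intro h t htm e he
    exact (eulerLagrange_chart_iff 𝒩 ρ hρ hJ hl hinv (fun i => (he i).1) ht hg hξ ha htm
      (fun i => (he i).2) (hμ t htm) rfl rfl).2
      fun i => (uniqueDiffOn_Icc ht t htm).eq_deriv _ (hμ t htm i) (h t htm i)

end Equivalences

end

end NetworkEP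

theorem mainTheorem6
    {E : Type*} [NormedAddCommGroup E] [NormedSpace ℝ E] [FiniteDimensional ℝ E]
    {G : Type*} [TopologicalSpace G] [ChartedSpace E G] [Group G] [LieGroup 𝓘(ℝ, E) ∞ G]
    {V : Type*} [NormedAddCommGroup V] [NormedSpace ℝ V] [FiniteDimensional ℝ V]
    {N : ℕ} (𝒩 : SimpleGraph (Fin N)) [DecidableRel 𝒩.Adj]
    -- the smooth left representation of `G` on `V`
    (ρ : G →* (V →L[ℝ] V))
    (hρ : ContMDiff 𝓘(ℝ, E) 𝓘(ℝ, V →L[ℝ] V) ∞ ρ)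
    -- the symmetric interaction tensor
    (J : Fin N → Fin N → StrongDual ℝ V →L[ℝ] V)
    (hJ : ∀ i j, 𝒩.Adj i j → ∀ a b : StrongDual ℝ V, a (J i j b) = b (J j i a))
    -- the smooth extended node Lagrangians, invariant under the diagonal left action of `G`
    (L : Fin N → TangentBundle 𝓘(ℝ, E) G → StrongDual ℝ V → ℝ)
    (hL : ∀ i, ContMDiff (𝓘(ℝ, E).tangent.prod 𝓘(ℝ, StrongDual ℝ V)) 𝓘(ℝ, ℝ) ∞
      (fun q : TangentBundle 𝓘(ℝ, E) G × StrongDual ℝ V => L i q.1 q.2))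
    (hinv : ∀ (i : Fin N) (h : G) (p : TangentBundle 𝓘(ℝ, E) G) (a : StrongDual ℝ V),
      L i (tangentMap 𝓘(ℝ, E) 𝓘(ℝ, E) (fun k : G => h * k) p) (NetworkEP.dualAct ρ h a) = L i p a)
    -- the parameters and the curve in `G^N`
    (A : Fin N → StrongDual ℝ V) (t₁ t₂ : ℝ) (ht : t₁ < t₂)
    (g : ℝ → Fin N → G)
    (hg : ∀ i, ContMDiffOn 𝓘(ℝ, ℝ) 𝓘(ℝ, E) ∞ (fun t => g t i) (Set.Icc t₁ t₂)) :
    let ξ : ℝ → Fin N → E :=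
      fun t i => NetworkEP.bodyVelocity (Set.Icc t₁ t₂) (fun s => g s i) t
    let a : ℝ → Fin N → StrongDual ℝ V := fun t i => NetworkEP.dualAct ρ (g t i)⁻¹ (A i)
    List.TFAE [
      NetworkEP.HamiltonPrinciple (fun p => NetworkEP.fullLagrangian 𝒩 ρ J L p A) t₁ t₂ g,
      NetworkEP.EulerLagrange (fun p => NetworkEP.fullLagrangian 𝒩 ρ J L p A) t₁ t₂ g,
      NetworkEP.ConstrainedPrinciple ρ (NetworkEP.reducedLagrangian 𝒩 ρ J L) t₁ t₂ ξ a,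
      NetworkEP.EulerPoincare 𝒩 ρ J (NetworkEP.nodeReduced L) t₁ t₂ ξ a] := by
  intro ξ a
  have hl := fun i => NetworkEP.contDiff_nodeReduced hL i
  tfae_have 1 → 4 :=
    NetworkEP.eulerPoincare_of_hamiltonPrinciple 𝒩 hρ hJ hl hinv ht hg rfl rfl
  tfae_have 4 → 3 :=
    NetworkEP.constrainedPrinciple_of_eulerPoincare 𝒩 hρ hJ hl ht hg rfl rfl
  tfae_have 3 → 1 :=
    NetworkEP.hamiltonPrinciple_of_constrainedPrinciple 𝒩 hρ hinv ht rfl rfl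
  tfae_have 2 ↔ 4 :=
    NetworkEP.eulerLagrange_iff_eulerPoincare 𝒩 hρ hJ hl hinv ht hg rfl rfl
  tfae_finish
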